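/- Let $1\le p<\infty$ and let $A\in\mathbb{R}^{m\times n}$ ($m,n\ge 1$) be a random matrix with i.i.d. mean-zero, unit-variance, sub-Gaussian entries. Put $K=\|A_{1,1}\|_{\psi_2}$, where $\|X\|_{\psi_2}=\inf\{t>0:\mathbb{E}[\exp(X^2/t^2)]\le 2\}$ is the sub-Gaussian norm. Let $\beta=\tfrac12$ if $p\le 2$ and $\beta=\tfrac1p$ if $p\ge 2$; write $\|z\|_p=(\sum_i|z_i|^p)^{1/p}$ for $z\in\mathbb{R}^m$. There are an absolute constant $C>0$ and constants $C'_p,C_p>0$ depending only on $p$ such that, with $$(d_p,D_p)=\begin{cases}(CK^{-3},\,1),&1\le p<2,\\(1,\,1),&p=2,\\(1,\,C'_pK),&2<p<\infty,\end{cases}$$ one has $d_p\|z\|_2\le\big(\mathbb{E}|\langle A_1,z\rangle|^p\big)^{1/p}\le D_p\|z\|_2$ for all $z\in\mathbb{R}^n$ (where $A_1$ is the first row of $A$), and, for every finite $T\subset\mathbb{R}^n$ with $N=|T|\ge 2$ and every $\epsilon\in(0,1)$, $$\mathbb{P}\Big(d_p(1-\epsilon)\|x-y\|_2\le\Big\|\frac{1}{m^{1/p}}A(x-y)\Big\|_p\le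 D_p(1+\epsilon)\|x-y\|_2\quad\forall x,y\in T\Big)\ \ge\ 1-2\exp\Big(-\frac{\epsilon^2m^{2\beta}}{d_p^{-2}\,C_p\,K^{8p+8}\log N}\Big).$$ -/

import Mathlib

open MeasureTheory ProbabilityTheory
open scoped ENNReal Matrix

/-- The `α`-Orlicz norm `inf {t > 0 : E[exp(|X|^α / t^α)] ≤ 2}` of a random variable `X`,
with values in `[0, ∞]` (the infimum of the empty set is `∞`). -/
noncomputable def orliczNorm {Ω : Type*} [MeasurableSpace Ω] (α : ℝ) (X : Ω → ℝ)
    (P : Measure Ω) : ℝ≥0∞ :=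
  ⨅ (t : ℝ) (_ : 0 < t)
    (_ : ∫⁻ ω, ENNReal.ofReal (Real.exp (|X ω| ^ α / t ^ α)) ∂P ≤ 2), ENNReal.ofReal t

/-- `X` is sub-Gaussian: its `2`-Orlicz norm is finite. -/
def IsSubGaussian {Ω : Type*} [MeasurableSpace Ω] (X : Ω → ℝ) (P : Measure Ω) : Prop :=
  orliczNorm 2 X P < ∞

/-- `A` is a random `m × n` matrix with i.i.d. mean-zero, unit-variance, sub-Gaussian entries. -/
structure IsSubGaussianEnsemble {Ω : Type*} [MeasurableSpace Ω] {m n : ℕ}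
    (A : Ω → Matrix (Fin m) (Fin n) ℝ) (P : Measure Ω) : Prop where
  measurable_entry : ∀ i j, Measurable fun ω => A ω i j
  indep : iIndepFun (fun (ij : Fin m × Fin n) ω => A ω ij.1 ij.2) P
  identDistrib : ∀ i j i' j', IdentDistrib (fun ω => A ω i j) (fun ω => A ω i' j') P P
  mean_zero : ∀ i j, ∫ ω, A ω i j ∂P = 0
  unit_variance : ∀ i j, variance (fun ω => A ω i j) P = 1
  subGaussian : ∀ i j, IsSubGaussian (fun ω => A ω i j) P

/-- The `ℓ_p` norm `(∑ |z_i|^p)^{1/p}` on `ℝ^m`. -/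
noncomputable def vecLpNorm {m : ℕ} (p : ℝ) (z : Fin m → ℝ) : ℝ :=
  (∑ i, |z i| ^ p) ^ (1 / p)

/-- The exponent `β`: `1/2` for `p ≤ 2`, and `1/p` for `p ≥ 2`. -/
noncomputable def betaExp (p : ℝ) : ℝ := if p ≤ 2 then 1 / 2 else 1 / p

/-- The lower constant `d_p`: `C K⁻³` for `p < 2`, and `1` for `p ≥ 2`. -/
noncomputable def lowerConst (C p K : ℝ) : ℝ := if p < 2 then C * K ^ (-3 : ℝ) else 1

/-- The upper constant `D_p`: `1` for `p ≤ 2`, and `C' K` for `p > 2`. -/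
noncomputable def upperConst (C' p K : ℝ) : ℝ := if p ≤ 2 then 1 else C' * K

/-! ### Elementary inequalities -/

/-! By homogeneity it suffices to treat a unit vector `u`. The coordinates of `A u` are then i.i.d.
with second moment 1, and `hasSqExpBound_mulVec` bounds their square-exponential moment at scale `τ
= 12K`: independence makes the variance proxies of the entries add, and decoupling with a Gaussian
converts the moment-generating function back into a square-exponential moment.

Monotonicity of moments, anchored at exponent 2, gives the constants equal to 1 in `d_p` and `D_p`.
The upper bound for `p > 2` is the sub-Gaussian moment bound; the lower bound for `p < 2` comes from
playing the second moment against the fourth (`le_integral_abs`).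

The core is `measureReal_sum_rpow_deviation_le`. The lower tail of `∑ |Yᵢ|^p` is a Chernoff bound
for nonnegative summands. For the upper tail `|Y|^p` may lack exponential moments, so it is
truncated at `B = m^(1/r)`, `r = max p 2`. On `|y| ≤ B` the growth beyond quadratic costs at most
`B^(r-2)`; a Chernoff parameter smaller by that factor gives the exponent `m^(2/r) = m^(2β)`, the
same order as the exponent `B²/τ²` for exceeding `B`.

A union bound over ordered pairs finishes. Its factors `N²` and `m` are absorbed in
`union_bound_le`: unless the asserted probability bound is trivial, `ε² m^(2β)` exceeds a multiple
of `K^(8p+8) log N`. -/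

lemma rpow_le_mul_exp {t s c : ℝ} (ht : 0 ≤ t) (hs : 0 < s) (hc : 0 < c) :
    t ^ s ≤ (s / c) ^ s * Real.exp (c * t) := by
  have h1 : t = (s / c) * (c * t / s) := by field_simp
  have h2 : c * t / s ≤ Real.exp (c * t / s) := by
    linarith [Real.add_one_le_exp (c * t / s)]
  calc t ^ s = (s / c) ^ s * (c * t / s) ^ s := by
        rw [← Real.mul_rpow (by positivity) (by positivity), ← h1]
    _ ≤ (s / c) ^ s * (Real.exp (c * t / s)) ^ s := by gcongr
    _ = _ := by rw [← Real.exp_mul]; congr 2; field_simp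

/-- Second-order Taylor remainder. The linear term stays exact, so that after integration the mean
enters without loss. -/
lemma exp_le_one_add_add_sq_mul_exp_abs (x : ℝ) :
    Real.exp x ≤ 1 + x + x ^ 2 * Real.exp |x| := by
  have h := Complex.norm_exp_sub_sum_le_norm_mul_exp (x : ℂ) 2
  have h2 : Complex.exp x - ∑ m ∈ Finset.range 2, (x : ℂ) ^ m / (m.factorial : ℂ)
      = ((Real.exp x - (1 + x) : ℝ) : ℂ) := by
    simp [Finset.sum_range_succ]
  rw [h2, Complex.norm_real, Complex.norm_real, Real.norm_eq_abs, Real.norm_eq_abs, sq_abs] at h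
  linarith [le_abs_self (Real.exp x - (1 + x))]

/-- With the sign fixed, the remainder carries no exponential factor; this is why the lower tail
needs only a second moment. -/
lemma exp_neg_le_one_sub_add_sq {x : ℝ} (hx : 0 ≤ x) : Real.exp (-x) ≤ 1 - x + x ^ 2 := by
  rcases le_total x 1 with h | h
  · have := Real.abs_exp_sub_one_sub_id_le (x := -x) (by rw [abs_neg, abs_of_nonneg hx]; exact h)
    have := (abs_le.1 this).2
    nlinarith
  · have : Real.exp (-x) ≤ 1 := Real.exp_le_one_iff.2 (by linarith)
    nlinarith

/-! ### Random variables with a bounded square-exponential moment -/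

/-- `Y` is measurable and `E[exp(Y² / τ²)] ≤ 2`. -/
structure HasSqExpBound {Ω : Type*} [MeasurableSpace Ω] (Y : Ω → ℝ) (τ : ℝ)
    (P : Measure Ω) : Prop where
  measurable : Measurable Y
  pos : 0 < τ
  integrable_exp : Integrable (fun ω => Real.exp (Y ω ^ 2 / τ ^ 2)) P
  integral_exp_le : ∫ ω, Real.exp (Y ω ^ 2 / τ ^ 2) ∂P ≤ 2

namespace HasSqExpBound

variable {Ω : Type*} [MeasurableSpace Ω] {P : Measure Ω} {Y : Ω → ℝ} {τ : ℝ}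

lemma of_lintegral_le (hY : Measurable Y) (hτ : 0 < τ)
    (h : ∫⁻ ω, ENNReal.ofReal (Real.exp (Y ω ^ 2 / τ ^ 2)) ∂P ≤ 2) : HasSqExpBound Y τ P where
  measurable := hY
  pos := hτ
  integrable_exp := by
    refine ⟨by fun_prop, ?_⟩
    rw [hasFiniteIntegral_iff_ofReal (ae_of_all _ fun ω => (Real.exp_pos _).le)]
    exact h.trans_lt (by simp)
  integral_exp_le := by
    rw [integral_eq_lintegral_of_nonneg_ae (ae_of_all _ fun ω => (Real.exp_pos _).le)
      (by fun_prop)]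
    exact ENNReal.toReal_le_of_le_ofReal (by norm_num) (by simpa using h)

/-- Pointwise domination by the square exponential gives integrability and a bound. -/
lemma integrable_of_le (h : HasSqExpBound Y τ P) {f : Ω → ℝ} (hf : Measurable f) {M : ℝ}
    (hle : ∀ ω, |f ω| ≤ M * Real.exp (Y ω ^ 2 / τ ^ 2)) : Integrable f P :=
  (h.integrable_exp.const_mul M).mono' hf.aestronglyMeasurable (ae_of_all _ hle)

lemma integral_le (h : HasSqExpBound Y τ P) {f : Ω → ℝ} (hf : Measurable f) {M : ℝ} (hM : 0 ≤ M)
    (hle : ∀ ω, |f ω| ≤ M * Real.exp (Y ω ^ 2 / τ ^ 2)) : ∫ ω, f ω ∂P ≤ 2 * M := by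
  calc ∫ ω, f ω ∂P ≤ ∫ ω, M * Real.exp (Y ω ^ 2 / τ ^ 2) ∂P :=
        integral_mono (h.integrable_of_le hf hle) (h.integrable_exp.const_mul M)
          fun ω => (le_abs_self _).trans (hle ω)
    _ = M * ∫ ω, Real.exp (Y ω ^ 2 / τ ^ 2) ∂P := integral_const_mul _ _
    _ ≤ M * 2 := by gcongr; exact h.integral_exp_le
    _ = 2 * M := mul_comm _ _

/-- Half of the square exponential pays for the power; the other half stays free to absorb an
exponential weight. -/
lemma rpow_mul_exp_le {s τ : ℝ} (hs : 0 < s) (hτ : 0 < τ) (y : ℝ) :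
    |y| ^ s * Real.exp (y ^ 2 / (2 * τ ^ 2)) ≤ s ^ (s / 2) * τ ^ s * Real.exp (y ^ 2 / τ ^ 2) := by
  have h1 := rpow_le_mul_exp (t := y ^ 2 / τ ^ 2) (s := s / 2) (c := 1 / 2) (by positivity)
    (by positivity) (by norm_num)
  have h2 : |y| ^ s = τ ^ s * (y ^ 2 / τ ^ 2) ^ (s / 2) := by
    rw [← div_pow, ← sq_abs, abs_div, abs_of_pos hτ, ← Real.rpow_natCast (|y| / τ) 2,
      ← Real.rpow_mul (by positivity), show ((2 : ℕ) : ℝ) * (s / 2) = s by push_cast; ring,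
      ← Real.mul_rpow hτ.le (by positivity), mul_div_cancel₀ _ hτ.ne']
  have h3 : s / 2 / (1 / 2) = s := by ring
  rw [h3] at h1
  rw [h2]
  calc τ ^ s * (y ^ 2 / τ ^ 2) ^ (s / 2) * Real.exp (y ^ 2 / (2 * τ ^ 2))
      ≤ τ ^ s * (s ^ (s / 2) * Real.exp (1 / 2 * (y ^ 2 / τ ^ 2)))
        * Real.exp (y ^ 2 / (2 * τ ^ 2)) := by gcongr
    _ = s ^ (s / 2) * τ ^ s * (Real.exp (1 / 2 * (y ^ 2 / τ ^ 2))
        * Real.exp (y ^ 2 / (2 * τ ^ 2))) := by ring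
    _ = _ := by rw [← Real.exp_add]; congr 2; field_simp; ring

lemma rpow_le {s τ : ℝ} (hs : 0 < s) (hτ : 0 < τ) (y : ℝ) :
    |y| ^ s ≤ s ^ (s / 2) * τ ^ s * Real.exp (y ^ 2 / τ ^ 2) :=
  (le_mul_of_one_le_right (by positivity) (Real.one_le_exp (by positivity))).trans
    (rpow_mul_exp_le hs hτ y)

lemma integrable_rpow (h : HasSqExpBound Y τ P) {s : ℝ} (hs : 0 < s) :
    Integrable (fun ω => |Y ω| ^ s) P := by
  have := h.measurable
  exact h.integrable_of_le (M := s ^ (s / 2) * τ ^ s) (by fun_prop) fun ω => by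
    rw [abs_of_nonneg (by positivity)]; exact rpow_le hs h.pos _

lemma integral_rpow_le (h : HasSqExpBound Y τ P) {s : ℝ} (hs : 0 < s) :
    ∫ ω, |Y ω| ^ s ∂P ≤ 2 * (s ^ (s / 2) * τ ^ s) := by
  have := h.measurable
  have := h.pos
  exact h.integral_le (by fun_prop) (by positivity) fun ω => by
    rw [abs_of_nonneg (by positivity)]; exact rpow_le hs h.pos _

lemma memLp (h : HasSqExpBound Y τ P) {s : ℝ} (hs : 0 < s) : MemLp Y (ENNReal.ofReal s) P := by
  rw [← integrable_norm_rpow_iff h.measurable.aestronglyMeasurable (by simpa using hs) (by simp)]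
  simpa [ENNReal.toReal_ofReal hs.le] using h.integrable_rpow hs

lemma integrable_sq (h : HasSqExpBound Y τ P) : Integrable (fun ω => Y ω ^ 2) P := by
  simpa using h.integrable_rpow (s := 2) (by norm_num)

/-- Integrating `1 + x ≤ exp x` gives `1 + 1/τ² ≤ 2`. The resulting `K ≥ 1` is what allows powers of
`K` to be compared later. -/
lemma one_le_of_integral_sq [IsProbabilityMeasure P] (h : HasSqExpBound Y τ P)
    (h2 : ∫ ω, Y ω ^ 2 ∂P = 1) : 1 ≤ τ := by
  have h1 : ∫ ω, (1 + Y ω ^ 2 / τ ^ 2) ∂P ≤ 2 := by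
    refine (integral_mono ?_ h.integrable_exp fun ω => ?_).trans h.integral_exp_le
    · exact (integrable_const _).add (h.integrable_sq.div_const _)
    · linarith [Real.add_one_le_exp (Y ω ^ 2 / τ ^ 2)]
  rw [integral_add (integrable_const _) (h.integrable_sq.div_const _), integral_div, h2] at h1
  simp only [integral_const, probReal_univ, smul_eq_mul, mul_one] at h1
  have h3 : 1 / τ ^ 2 ≤ 1 := by linarith
  have := h.pos
  rw [div_le_one (by positivity)] at h3
  nlinarith

/-- The sub-Gaussian tail bound. -/
lemma measure_abs_gt_le [IsFiniteMeasure P] (h : HasSqExpBound Y τ P) {B : ℝ} (hB : 0 ≤ B) :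
    P.real {ω | B < |Y ω|} ≤ 2 * Real.exp (-(B ^ 2 / τ ^ 2)) := by
  have h1 := mul_meas_ge_le_integral_of_nonneg (μ := P)
    (ae_of_all _ fun ω => (Real.exp_pos (Y ω ^ 2 / τ ^ 2)).le) h.integrable_exp
    (Real.exp (B ^ 2 / τ ^ 2))
  have h2 : P.real {ω | B < |Y ω|}
      ≤ P.real {ω | Real.exp (B ^ 2 / τ ^ 2) ≤ Real.exp (Y ω ^ 2 / τ ^ 2)} := by
    refine measureReal_mono fun ω hω => ?_
    have hω' : B < |Y ω| := hω
    simp only [Set.mem_ofPred_eq, Real.exp_le_exp]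
    gcongr ?_ / _
    rw [← sq_abs (Y ω)]
    gcongr
  rw [Real.exp_neg, ← div_eq_mul_inv, le_div_iff₀ (Real.exp_pos _), mul_comm]
  calc _ ≤ _ := mul_le_mul_of_nonneg_left h2 (Real.exp_pos _).le
    _ ≤ _ := h1
    _ ≤ 2 := h.integral_exp_le

/-- A centred variable with a bounded square-exponential moment has a sub-Gaussian
moment-generating function. -/
lemma hasSubgaussianMGF [IsProbabilityMeasure P] (h : HasSqExpBound Y τ P)
    (h0 : ∫ ω, Y ω ∂P = 0) : HasSubgaussianMGF Y ⟨9 * τ ^ 2, by positivity⟩ P := by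
  have hm := h.measurable
  have hτ := h.pos
  -- AM-GM, weighted to spend only half of the available exponent `y²/τ²`; the other half controls
  -- the factor `y²` in the Taylor remainder.
  have key : ∀ t y : ℝ, |t * y| ≤ t ^ 2 * τ ^ 2 / 2 + y ^ 2 / (2 * τ ^ 2) := by
    intro t y
    have h1 : t ^ 2 * τ ^ 2 / 2 + y ^ 2 / (2 * τ ^ 2) - |t * y|
        = (|t| * τ - |y| / τ) ^ 2 / 2 := by
      rw [abs_mul, ← sq_abs t, ← sq_abs y]; field_simp; ring
    nlinarith [sq_nonneg (|t| * τ - |y| / τ)]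
  have hexp : ∀ t y : ℝ, Real.exp |t * y| ≤
      Real.exp (t ^ 2 * τ ^ 2 / 2) * Real.exp (y ^ 2 / (2 * τ ^ 2)) := fun t y => by
    rw [← Real.exp_add]; exact Real.exp_le_exp.2 (key t y)
  have hint : ∀ t, Integrable (fun ω => Real.exp (t * Y ω)) P := fun t =>
    h.integrable_of_le (M := Real.exp (t ^ 2 * τ ^ 2 / 2)) (by fun_prop) fun ω => by
      rw [abs_of_pos (Real.exp_pos _)]
      refine (Real.exp_le_exp.2 (le_abs_self _)).trans ((hexp t (Y ω)).trans ?_)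
      gcongr
      linarith [sq_nonneg τ]
  have hY : Integrable Y P := by
    refine h.integrable_of_le (M := 1 ^ (1 / 2 : ℝ) * τ ^ (1 : ℝ)) hm fun ω => ?_
    simpa using rpow_le one_pos hτ (Y ω)
  refine ⟨hint, fun t => ?_⟩
  set u := t ^ 2 * τ ^ 2 with hu
  have hu0 : 0 ≤ u := by positivity
  have hle : ∀ ω, |(t * Y ω) ^ 2 * Real.exp (|t * Y ω|)|
      ≤ (2 * u * Real.exp (u / 2)) * Real.exp (Y ω ^ 2 / τ ^ 2) := fun ω => by
    rw [abs_of_nonneg (by positivity)]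
    have h2 := rpow_mul_exp_le (s := 2) (by norm_num) hτ (Y ω)
    norm_num at h2
    calc (t * Y ω) ^ 2 * Real.exp |t * Y ω|
        ≤ (t * Y ω) ^ 2 * (Real.exp (u / 2) * Real.exp (Y ω ^ 2 / (2 * τ ^ 2))) := by
          gcongr; exact hexp _ _
      _ = t ^ 2 * Real.exp (u / 2) * (Y ω ^ 2 * Real.exp (Y ω ^ 2 / (2 * τ ^ 2))) := by ring
      _ ≤ t ^ 2 * Real.exp (u / 2) * (2 * τ ^ 2 * Real.exp (Y ω ^ 2 / τ ^ 2)) := by gcongr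
      _ = _ := by rw [hu]; ring
  have hmeas2 : Measurable fun ω => (t * Y ω) ^ 2 * Real.exp |t * Y ω| := by fun_prop
  have hi2 := h.integrable_of_le hmeas2 hle
  have hb2 := h.integral_le hmeas2 (by positivity) hle
  have hi1 : Integrable (fun ω => 1 + t * Y ω) P := (integrable_const _).add (hY.const_mul t)
  calc mgf Y P t ≤ ∫ ω, (1 + t * Y ω + (t * Y ω) ^ 2 * Real.exp |t * Y ω|) ∂P :=
        integral_mono (hint t) (hi1.add hi2) fun ω => exp_le_one_add_add_sq_mul_exp_abs _
    _ = 1 + ∫ ω, (t * Y ω) ^ 2 * Real.exp |t * Y ω| ∂P := by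
        rw [integral_add hi1 hi2, integral_add (integrable_const _) (hY.const_mul t),
          integral_const_mul, h0]
        simp
    _ ≤ 1 + 4 * u * Real.exp (u / 2) := by linarith
    _ ≤ Real.exp (u / 2) + 4 * u * Real.exp (u / 2) := by
        gcongr; exact Real.one_le_exp (by positivity)
    _ = (4 * u + 1) * Real.exp (u / 2) := by ring
    _ ≤ Real.exp (4 * u) * Real.exp (u / 2) := by gcongr; exact Real.add_one_le_exp _
    _ = _ := by
        rw [← Real.exp_add]
        congr 1
        change _ = 9 * τ ^ 2 * t ^ 2 / 2
        rw [hu]; ring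

end HasSqExpBound

/-- The weight turns the standard Gaussian density into `√2` times the density of variance 2, so the
integral is `√2`. -/
lemma lintegral_exp_sq_div_four_gaussianReal :
    ∫⁻ g, ENNReal.ofReal (Real.exp (g ^ 2 / 4)) ∂(gaussianReal 0 1) ≤ 2 := by
  have h1 : ∀ g : ℝ, gaussianPDF 0 1 g * ENNReal.ofReal (Real.exp (g ^ 2 / 4))
      = ENNReal.ofReal (√2) * ENNReal.ofReal (gaussianPDFReal 0 2 g) := fun g => by
    rw [gaussianPDF, ← ENNReal.ofReal_mul (gaussianPDFReal_nonneg _ _ _),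
      ← ENNReal.ofReal_mul (by positivity)]
    congr 1
    simp only [gaussianPDFReal, sub_zero, NNReal.coe_one, mul_one, NNReal.coe_ofNat]
    rw [mul_assoc, ← Real.exp_add, ← mul_assoc]
    congr 1
    · rw [show 2 * Real.pi * 2 = 2 * (2 * Real.pi) by ring, Real.sqrt_mul (by norm_num) (2 * Real.pi),
        mul_inv, ← mul_assoc, mul_inv_cancel₀ (by positivity), one_mul]
    · congr 1; ring
  rw [gaussianReal_of_var_ne_zero _ one_ne_zero,
    lintegral_withDensity_eq_lintegral_mul _ (measurable_gaussianPDF _ _) (by fun_prop)]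
  simp only [Pi.mul_apply, h1]
  rw [lintegral_const_mul' _ _ (by simp), lintegral_gaussianPDFReal_eq_one _ (by norm_num), mul_one]
  rw [show (2 : ℝ≥0∞) = ENNReal.ofReal 2 by simp]
  refine ENNReal.ofReal_le_ofReal ?_
  rw [Real.sqrt_le_left (by norm_num)]; norm_num

/-- A sub-Gaussian moment-generating function gives a bounded square-exponential moment, by
decoupling with an independent Gaussian. -/
lemma ProbabilityTheory.HasSubgaussianMGF.hasSqExpBound {Ω : Type*} [MeasurableSpace Ω]
    {P : Measure Ω} [IsProbabilityMeasure P] {Y : Ω → ℝ} {c : NNReal}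
    (h : HasSubgaussianMGF Y c P) (hY : Measurable Y) (hc : 0 < c) :
    HasSqExpBound Y (2 * √c) P := by
  have hc' : (0 : ℝ) < c := hc
  refine .of_lintegral_le hY (by positivity) ?_
  -- With `t² = 1/(2c)`, averaging `exp(t y g)` over `g` gives `exp(y²/(4c))`, while averaging over
  -- `Y` first gives at most `exp(g²/4)`.
  set t : ℝ := 1 / √(2 * c) with ht
  have ht2 : t ^ 2 = 1 / (2 * c) := by rw [ht, div_pow, Real.sq_sqrt (by positivity)]; norm_num
  have h1 : ∀ y : ℝ, ENNReal.ofReal (Real.exp (y ^ 2 / (2 * √c) ^ 2))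
      = ∫⁻ g, ENNReal.ofReal (Real.exp (t * y * g)) ∂(gaussianReal 0 1) := fun y => by
    rw [← ofReal_integral_eq_lintegral_ofReal (integrable_exp_mul_gaussianReal _)
      (ae_of_all _ fun g => (Real.exp_pos _).le)]
    congr 1
    have := congrFun (mgf_fun_id_gaussianReal (μ := 0) (v := 1)) (t * y)
    rw [mgf] at this
    rw [this]
    congr 1
    rw [mul_pow, mul_pow, Real.sq_sqrt hc'.le, ht2]
    simp only [NNReal.coe_one]
    field_simp
    ring
  simp only [h1]
  rw [lintegral_lintegral_swap (by fun_prop)]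
  refine (lintegral_mono fun g => ?_).trans lintegral_exp_sq_div_four_gaussianReal
  have h2 : ∀ ω, t * Y ω * g = (t * g) * Y ω := fun ω => by ring
  simp only [h2]
  rw [← ofReal_integral_eq_lintegral_ofReal (h.integrable_exp_mul _)
      (ae_of_all _ fun g => (Real.exp_pos _).le)]
  refine ENNReal.ofReal_le_ofReal ((h.mgf_le (t * g)).trans (Real.exp_le_exp.2 (le_of_eq ?_)))
  rw [mul_pow, ht2]
  field_simp
  ring

/-! ### Deviation bounds for empirical `p`-th moments -/

section Deviation

variable {Ω ι : Type*} [MeasurableSpace Ω] {P : Measure Ω} [IsProbabilityMeasure P] [Fintype ι]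

/-- Chernoff bound for a sum of independent variables with `E[exp Uᵢ] ≤ exp b`. -/
lemma measureReal_le_sum_le_exp_of_iIndepFun {U : ι → Ω → ℝ} (hU : ∀ i, Measurable (U i))
    (hind : iIndepFun U P) (hint : ∀ i, Integrable (fun ω => Real.exp (U i ω)) P) {b : ℝ}
    (hb : ∀ i, ∫ ω, Real.exp (U i ω) ∂P ≤ Real.exp b) (t : ℝ) :
    P.real {ω | t ≤ ∑ i, U i ω} ≤ Real.exp (Fintype.card ι * b - t) := by
  have hi := hind.integrable_exp_mul_sum (t := 1) hU (s := Finset.univ)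
    (fun i _ => by simpa using hint i)
  have h := measure_ge_le_exp_mul_mgf (X := ∑ i, U i) (μ := P) t zero_le_one hi
  rw [hind.mgf_sum hU] at h
  simp only [Finset.sum_apply] at h
  refine h.trans ?_
  have h2 : ∏ i, mgf (U i) P 1 ≤ ∏ _i : ι, Real.exp b :=
    Finset.prod_le_prod (fun i _ => mgf_nonneg) fun i _ => by simpa [mgf] using hb i
  rw [Finset.prod_const, Finset.card_univ, ← Real.exp_nat_mul] at h2
  calc _ ≤ Real.exp (-1 * t) * Real.exp (Fintype.card ι * b) := by gcongr
    _ = _ := by rw [← Real.exp_add]; congr 1; ring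

variable {Y : ι → Ω → ℝ} {τ p v : ℝ}

/-- The constant bounding the second moment of `|Y|^p`. -/
noncomputable def secondMomentBound (p τ : ℝ) : ℝ := 4 * ((2 * p) ^ p * τ ^ (2 * p))

lemma sq_rpow_mul_exp_le {p τ : ℝ} (hp : 0 < p) (hτ : 0 < τ) (y : ℝ) :
    (|y| ^ p) ^ 2 * Real.exp (y ^ 2 / (2 * τ ^ 2))
      ≤ (2 * p) ^ p * τ ^ (2 * p) * Real.exp (y ^ 2 / τ ^ 2) := by
  have h := HasSqExpBound.rpow_mul_exp_le (s := 2 * p) (by positivity) hτ y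
  rw [show 2 * p / 2 = p by ring] at h
  rwa [← Real.rpow_natCast, ← Real.rpow_mul (abs_nonneg y), mul_comm p, Nat.cast_ofNat]

/-- Lower tail: no truncation is necessary, since the summands are nonnegative. -/
lemma measureReal_sum_rpow_le (hY : ∀ i, HasSqExpBound (Y i) τ P) (hind : iIndepFun Y P)
    (hp : 0 < p) (hv : ∀ i, ∫ ω, |Y i ω| ^ p ∂P = v) {c : ℝ} (hc : 0 ≤ c) (δ : ℝ) :
    P.real {ω | ∑ i, |Y i ω| ^ p ≤ Fintype.card ι * (v - δ)}
      ≤ Real.exp (Fintype.card ι * (c ^ 2 * secondMomentBound p τ - c * δ)) := by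
  have hm := fun i => (hY i).measurable
  have hg : ∀ i, Measurable fun ω => -(c * |Y i ω| ^ p) := fun i => by fun_prop
  have hind' : iIndepFun (fun i ω => -(c * |Y i ω| ^ p)) P :=
    hind.comp (fun _ y => -(c * |y| ^ p)) fun _ => by fun_prop
  have hint : ∀ i, Integrable (fun ω => Real.exp (-(c * |Y i ω| ^ p))) P := fun i =>
    (integrable_const (1 : ℝ)).mono' (hg i).exp.aestronglyMeasurable (ae_of_all _ fun ω => by
      rw [Real.norm_eq_abs, abs_of_pos (Real.exp_pos _), Real.exp_le_one_iff]
      have : 0 ≤ c * |Y i ω| ^ p := by positivity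
      linarith)
  have hb : ∀ i, ∫ ω, Real.exp (-(c * |Y i ω| ^ p)) ∂P
      ≤ Real.exp (-(c * v) + c ^ 2 * secondMomentBound p τ) := fun i => by
    have hτ := (hY i).pos
    have h1 : Integrable (fun ω => 1 - c * |Y i ω| ^ p) P :=
      (integrable_const _).sub (((hY i).integrable_rpow hp).const_mul c)
    have hle : ∀ ω, |(|Y i ω| ^ p) ^ 2|
        ≤ ((2 * p) ^ p * τ ^ (2 * p)) * Real.exp (Y i ω ^ 2 / τ ^ 2) := fun ω => by
      rw [abs_of_nonneg (by positivity)]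
      exact (le_mul_of_one_le_right (by positivity) (Real.one_le_exp (by positivity))).trans
        (sq_rpow_mul_exp_le hp hτ (Y i ω))
    have h2 : Integrable (fun ω => (|Y i ω| ^ p) ^ 2) P :=
      (hY i).integrable_of_le (by fun_prop) hle
    have h3 : ∫ ω, (|Y i ω| ^ p) ^ 2 ∂P ≤ secondMomentBound p τ := by
      refine ((hY i).integral_le (by fun_prop) (by positivity) hle).trans ?_
      unfold secondMomentBound
      gcongr
      norm_num
    calc ∫ ω, Real.exp (-(c * |Y i ω| ^ p)) ∂P
        ≤ ∫ ω, (1 - c * |Y i ω| ^ p + c ^ 2 * (|Y i ω| ^ p) ^ 2) ∂P := by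
          refine integral_mono (hint i) (h1.add (h2.const_mul _)) fun ω => ?_
          have := exp_neg_le_one_sub_add_sq (x := c * |Y i ω| ^ p) (by positivity)
          rwa [mul_pow] at this
      _ = 1 - c * v + c ^ 2 * ∫ ω, (|Y i ω| ^ p) ^ 2 ∂P := by
          rw [integral_add h1 (h2.const_mul _),
            integral_sub (integrable_const _) (((hY i).integrable_rpow hp).const_mul c),
            integral_const_mul, integral_const_mul, hv i]
          simp
      _ ≤ 1 - c * v + c ^ 2 * secondMomentBound p τ := by gcongr
      _ ≤ _ := by
          linarith [Real.add_one_le_exp (-(c * v) + c ^ 2 * secondMomentBound p τ)]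
  have h := measureReal_le_sum_le_exp_of_iIndepFun hg hind' hint hb
    (-(c * (Fintype.card ι * (v - δ))))
  refine (measureReal_mono fun ω hω => ?_).trans (h.trans (Real.exp_le_exp.2 (by
    apply le_of_eq; ring)))
  have hω' : ∑ i, |Y i ω| ^ p ≤ Fintype.card ι * (v - δ) := hω
  change -(c * (Fintype.card ι * (v - δ))) ≤ ∑ i, -(c * |Y i ω| ^ p)
  rw [Finset.sum_neg_distrib, ← Finset.mul_sum]
  gcongr

/-- Upper tail, by truncation at a level `B` for which `c |y|^p` is dominated by a quadratic. -/
lemma measureReal_le_sum_rpow (hY : ∀ i, HasSqExpBound (Y i) τ P) (hind : iIndepFun Y P)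
    (hp : 0 < p) (hτ1 : 1 ≤ τ) (hv : ∀ i, ∫ ω, |Y i ω| ^ p ∂P = v) {c B : ℝ} (hc : 0 ≤ c)
    (hB : 0 ≤ B) (hcB : ∀ y : ℝ, |y| ≤ B → c * |y| ^ p ≤ (1 + y ^ 2) / (2 * τ ^ 2)) (δ : ℝ) :
    P.real {ω | Fintype.card ι * (v + δ) ≤ ∑ i, |Y i ω| ^ p}
      ≤ Real.exp (Fintype.card ι * (c ^ 2 * secondMomentBound p τ - c * δ))
        + Fintype.card ι * (2 * Real.exp (-(B ^ 2 / τ ^ 2))) := by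
  have hm := fun i => (hY i).measurable
  have hτ : 0 < τ := by linarith
  -- The truncated summand is dominated by a quadratic, so `exp (g y)` costs only half of the square
  -- exponential even when `p > 2`.
  set g : ℝ → ℝ := fun y => c * Set.indicator {y : ℝ | |y| ≤ B} (fun y => |y| ^ p) y with hg
  have hgm : Measurable g := by
    refine Measurable.const_mul (Measurable.indicator (by fun_prop) ?_) c
    exact measurableSet_le (by fun_prop) (by fun_prop)
  have hg0 : ∀ y, 0 ≤ g y := fun y =>
    mul_nonneg hc (Set.indicator_nonneg (fun y _ => by positivity) y)
  have hgle : ∀ y, g y ≤ c * |y| ^ p := fun y =>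
    mul_le_mul_of_nonneg_left (Set.indicator_le_self' (fun y _ => by positivity) y) hc
  have hgeq : ∀ y, |y| ≤ B → g y = c * |y| ^ p := fun y hy => by
    simp only [hg]; rw [Set.indicator_of_mem (show y ∈ {y : ℝ | |y| ≤ B} from hy)]
  have hgq : ∀ y, g y ≤ (1 + y ^ 2) / (2 * τ ^ 2) := fun y => by
    by_cases hy : |y| ≤ B
    · rw [hgeq y hy]; exact hcB y hy
    · have : g y = 0 := by
        simp only [hg]; rw [Set.indicator_of_notMem (show y ∉ {y : ℝ | |y| ≤ B} from hy), mul_zero]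
      rw [this]; positivity
  have hexp2 : Real.exp (1 / (2 * τ ^ 2)) ≤ 2 := by
    have h1 : 1 / (2 * τ ^ 2) ≤ 1 / 2 := by
      apply one_div_le_one_div_of_le <;> nlinarith
    have h2 : Real.exp (1 / 2 : ℝ) ^ 2 ≤ 2 ^ 2 := by
      rw [← Real.exp_nat_mul]; norm_num
      linarith [Real.exp_one_lt_d9]
    exact (Real.exp_le_exp.2 h1).trans ((pow_le_pow_iff_left₀ (by positivity) (by norm_num) two_ne_zero).1 h2)
  have hexpg : ∀ y, Real.exp (g y) ≤ 2 * Real.exp (y ^ 2 / (2 * τ ^ 2)) := fun y => by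
    calc Real.exp (g y) ≤ Real.exp (1 / (2 * τ ^ 2) + y ^ 2 / (2 * τ ^ 2)) := by
          rw [← add_div]; exact Real.exp_le_exp.2 (hgq y)
      _ = Real.exp (1 / (2 * τ ^ 2)) * Real.exp (y ^ 2 / (2 * τ ^ 2)) := Real.exp_add _ _
      _ ≤ _ := by gcongr
  have hind' : iIndepFun (fun i ω => g (Y i ω)) P := hind.comp (fun _ => g) fun _ => hgm
  have hgY : ∀ i, Measurable fun ω => g (Y i ω) := fun i => hgm.comp (hm i)
  have hint : ∀ i, Integrable (fun ω => Real.exp (g (Y i ω))) P := fun i =>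
    (hY i).integrable_of_le (M := 2) (hgY i).exp fun ω => by
      rw [abs_of_pos (Real.exp_pos _)]
      refine (hexpg _).trans ?_
      gcongr
      linarith [sq_nonneg τ]
  have hb : ∀ i, ∫ ω, Real.exp (g (Y i ω)) ∂P
      ≤ Real.exp (c * v + c ^ 2 * secondMomentBound p τ) := fun i => by
    have h1 : Integrable (fun ω => 1 + c * |Y i ω| ^ p) P :=
      (integrable_const _).add (((hY i).integrable_rpow hp).const_mul c)
    have hle : ∀ ω, |(|Y i ω| ^ p) ^ 2 * Real.exp (g (Y i ω))|
        ≤ (2 * ((2 * p) ^ p * τ ^ (2 * p))) * Real.exp (Y i ω ^ 2 / τ ^ 2) := fun ω => by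
      rw [abs_of_nonneg (by positivity)]
      calc (|Y i ω| ^ p) ^ 2 * Real.exp (g (Y i ω))
          ≤ (|Y i ω| ^ p) ^ 2 * (2 * Real.exp (Y i ω ^ 2 / (2 * τ ^ 2))) := by
            gcongr; exact hexpg _
        _ = 2 * ((|Y i ω| ^ p) ^ 2 * Real.exp (Y i ω ^ 2 / (2 * τ ^ 2))) := by ring
        _ ≤ 2 * ((2 * p) ^ p * τ ^ (2 * p) * Real.exp (Y i ω ^ 2 / τ ^ 2)) := by
            exact mul_le_mul_of_nonneg_left (sq_rpow_mul_exp_le hp hτ _) zero_le_two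
        _ = _ := by ring
    have hmeas : Measurable fun ω => (|Y i ω| ^ p) ^ 2 * Real.exp (g (Y i ω)) :=
      Measurable.mul (by fun_prop) (hgY i).exp
    have h2 : Integrable (fun ω => (|Y i ω| ^ p) ^ 2 * Real.exp (g (Y i ω))) P :=
      (hY i).integrable_of_le hmeas hle
    -- The factor 4 in `secondMomentBound` arises here: 2 from the square-exponential moment and 2
    -- from `hexp2`.
    have h3 : ∫ ω, (|Y i ω| ^ p) ^ 2 * Real.exp (g (Y i ω)) ∂P ≤ secondMomentBound p τ := by
      refine ((hY i).integral_le hmeas (by positivity) hle).trans (le_of_eq ?_)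
      unfold secondMomentBound
      ring
    calc ∫ ω, Real.exp (g (Y i ω)) ∂P
        ≤ ∫ ω, (1 + c * |Y i ω| ^ p
            + c ^ 2 * ((|Y i ω| ^ p) ^ 2 * Real.exp (g (Y i ω)))) ∂P := by
          refine integral_mono (hint i) (h1.add (h2.const_mul _)) fun ω => ?_
          have h4 := exp_le_one_add_add_sq_mul_exp_abs (g (Y i ω))
          rw [abs_of_nonneg (hg0 _)] at h4
          refine h4.trans ?_
          rw [← mul_assoc, ← mul_pow]
          have h5 := hgle (Y i ω)
          have h6 := hg0 (Y i ω)
          gcongr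
      _ = 1 + c * v + c ^ 2 * ∫ ω, (|Y i ω| ^ p) ^ 2 * Real.exp (g (Y i ω)) ∂P := by
          rw [integral_add h1 (h2.const_mul _),
            integral_add (integrable_const _) (((hY i).integrable_rpow hp).const_mul c),
            integral_const_mul, integral_const_mul, hv i]
          simp
      _ ≤ 1 + c * v + c ^ 2 * secondMomentBound p τ := by gcongr
      _ ≤ _ := by
          linarith [Real.add_one_le_exp (c * v + c ^ 2 * secondMomentBound p τ)]
  have h := measureReal_le_sum_le_exp_of_iIndepFun hgY hind' hint hb
    (c * (Fintype.card ι * (v + δ)))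
  -- If no `|Yᵢ|` exceeds `B`, truncation changes nothing; otherwise the single-variable tail bound
  -- applies.
  have hsub : {ω | Fintype.card ι * (v + δ) ≤ ∑ i, |Y i ω| ^ p}
      ⊆ {ω | c * (Fintype.card ι * (v + δ)) ≤ ∑ i, g (Y i ω)} ∪ ⋃ i, {ω | B < |Y i ω|} := by
    intro ω hω
    by_cases hex : ∃ i, B < |Y i ω|
    · exact Or.inr (Set.mem_iUnion.2 hex)
    · push Not at hex
      left
      change _ ≤ ∑ i, g (Y i ω)
      rw [Finset.sum_congr rfl fun i _ => hgeq _ (hex i), ← Finset.mul_sum]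
      exact mul_le_mul_of_nonneg_left hω hc
  refine (measureReal_mono hsub).trans ((measureReal_union_le _ _).trans ?_)
  refine add_le_add (h.trans (Real.exp_le_exp.2 (by apply le_of_eq; ring))) ?_
  refine (measureReal_iUnion_fintype_le _).trans ?_
  calc _ ≤ ∑ _i : ι, 2 * Real.exp (-(B ^ 2 / τ ^ 2)) :=
        Finset.sum_le_sum fun i _ => (hY i).measure_abs_gt_le hB
    _ = _ := by rw [Finset.sum_const, Finset.card_univ, nsmul_eq_mul]

end Deviation

/-- The `p`-dependent constant in the deviation bound for empirical `p`-th moments. -/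
noncomputable def deviationConst (p : ℝ) : ℝ := 16 * (2 * p) ^ p * 16 ^ (2 * p)

lemma deviationConst_pos {p : ℝ} (hp : 1 ≤ p) : 0 < deviationConst p := by
  unfold deviationConst; positivity

/-- Supplies the quadratic domination needed for truncation. The summand 1 handles `|y| ≤ 1`, where
`|y|^p` may exceed `y²`. -/
lemma rpow_le_one_add_sq_mul {p r B y : ℝ} (hp : 0 ≤ p) (hpr : p ≤ r) (hr : 2 ≤ r) (hB : 1 ≤ B)
    (hy : |y| ≤ B) : |y| ^ p ≤ (1 + y ^ 2) * B ^ (r - 2) := by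
  have hB1 : 1 ≤ B ^ (r - 2) := Real.one_le_rpow hB (by linarith)
  rcases le_total |y| 1 with h | h
  · calc |y| ^ p ≤ 1 := Real.rpow_le_one (abs_nonneg y) h hp
      _ = 1 * 1 := by ring
      _ ≤ _ := by gcongr; nlinarith [sq_nonneg y]
  · calc |y| ^ p ≤ |y| ^ r := Real.rpow_le_rpow_of_exponent_le h hpr
      _ = |y| ^ 2 * |y| ^ (r - 2) := by
        rw [← Real.rpow_natCast, ← Real.rpow_add (by linarith)]; congr 1; push_cast; ring
      _ ≤ (1 + y ^ 2) * B ^ (r - 2) := by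
        rw [sq_abs]
        have : |y| ^ (r - 2) ≤ B ^ (r - 2) :=
          Real.rpow_le_rpow (abs_nonneg y) hy (by linarith)
        gcongr
        linarith

/-- Two-sided deviation bound for the empirical `p`-th moment of i.i.d. sub-Gaussian variables. -/
lemma measureReal_sum_rpow_deviation_le {Ω ι : Type*} [MeasurableSpace Ω] {P : Measure Ω}
    [IsProbabilityMeasure P] [Fintype ι] [Nonempty ι] {Y : ι → Ω → ℝ} {τ p v ε : ℝ}
    (hY : ∀ i, HasSqExpBound (Y i) τ P) (hind : iIndepFun Y P) (hp : 1 ≤ p) (hτ : 1 ≤ τ)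
    (hv : ∀ i, ∫ ω, |Y i ω| ^ p ∂P = v) (hε : 0 < ε) (hε1 : ε < 1) :
    P.real {ω | ¬ (Fintype.card ι * (v - ε * (16 * τ ^ 2) ^ (-p)) < ∑ i, |Y i ω| ^ p ∧
        ∑ i, |Y i ω| ^ p < Fintype.card ι * (v + ε * (16 * τ ^ 2) ^ (-p)))}
      ≤ 2 * Real.exp (-(ε ^ 2 * (Fintype.card ι : ℝ) ^ (2 / max p 2)
            / (deviationConst p * τ ^ (6 * p + 2))))
        + 2 * Fintype.card ι * Real.exp (-((Fintype.card ι : ℝ) ^ (2 / max p 2) / τ ^ 2)) := by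
  set r := max p 2 with hr
  set m : ℝ := (Fintype.card ι : ℝ) with hm
  have hm1 : 1 ≤ m := Nat.one_le_cast.2 Fintype.card_pos
  have hm0 : 0 < m := by linarith
  have hτ0 : 0 < τ := by linarith
  have hr2 : 2 ≤ r := le_max_right _ _
  set l := (16 * τ ^ 2) ^ (-p) with hl
  set Q := secondMomentBound p τ with hQ
  have hl0 : 0 < l := by positivity
  have hl1 : l ≤ 1 := Real.rpow_le_one_of_one_le_of_nonpos (by nlinarith) (by linarith)
  have hQ1 : 1 ≤ Q := by
    have h1 : 1 ≤ (2 * p) ^ p := Real.one_le_rpow (by linarith) (by linarith)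
    have h2 : 1 ≤ τ ^ (2 * p) := Real.one_le_rpow hτ (by linarith)
    have h3 := one_le_mul_of_one_le_of_one_le h1 h2
    rw [hQ, secondMomentBound]; linarith
  -- `w` cancels the loss `B^(r-2)` from truncation, and `m * w = B² = m^(2/r)` makes both error
  -- exponents of the same order in `m`.
  set w := m ^ (2 / r - 1) with hw
  have hw0 : 0 < w := by positivity
  have hw1 : w ≤ 1 := Real.rpow_le_one_of_one_le_of_nonpos hm1 (by
    rw [sub_nonpos, div_le_one (by linarith)]; exact hr2)
  have hmw : m * w = m ^ (2 / r) := by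
    rw [hw, ← Real.rpow_one_add' hm0.le (by rw [add_sub_cancel]; positivity), add_sub_cancel]
  set B := m ^ (1 / r) with hB
  have hB1 : 1 ≤ B := Real.one_le_rpow hm1 (by positivity)
  have hwB : w * B ^ (r - 2) = 1 := by
    rw [hB, hw, ← Real.rpow_mul hm0.le, ← Real.rpow_add hm0]
    convert Real.rpow_zero m using 2
    field_simp; ring
  have hB2 : B ^ 2 = m ^ (2 / r) := by
    rw [hB, ← Real.rpow_natCast, ← Real.rpow_mul hm0.le]; congr 1; push_cast; ring
  -- Small enough for the quadratic Chernoff term to use at most half of the linear one (`hcQ`) and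
  -- for the domination `hcB`.
  set c := ε * l * w / (2 * Q * τ ^ 2) with hc
  have hc0 : 0 < c := by positivity
  have hτ2 : 1 ≤ τ ^ 2 := by nlinarith
  have hcQ : c * Q ≤ ε * l / 2 := by
    rw [hc, show ε * l * w / (2 * Q * τ ^ 2) * Q = ε * l / 2 * (w / τ ^ 2) by field_simp]
    refine mul_le_of_le_one_right (by positivity) ?_
    rw [div_le_one (by positivity)]; linarith
  have hexp : m * (c ^ 2 * Q - c * (ε * l))
      ≤ -(ε ^ 2 * m ^ (2 / r) / (deviationConst p * τ ^ (6 * p + 2))) := by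
    have h1 : c ^ 2 * Q - c * (ε * l) ≤ -(c * (ε * l) / 2) := by nlinarith
    -- Origin of `6p + 2`: `Q` contributes `τ^(2p)`, `l⁻²` contributes `τ^(4p)`, and the choice of
    -- `c` contributes `τ²`.
    have h2 : 4 * Q * τ ^ 2 = deviationConst p * τ ^ (6 * p + 2) * l ^ 2 := by
      have e1 : τ ^ (6 * p + 2) = τ ^ (2 * p) * τ ^ 2 * (τ ^ (2 * p)) ^ 2 := by
        rw [show 6 * p + 2 = 2 * p + 2 + 2 * p + 2 * p by ring, Real.rpow_add hτ0,
          Real.rpow_add hτ0, Real.rpow_add hτ0, Real.rpow_two]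
        ring
      have e2 : l * 16 ^ p * τ ^ (2 * p) = 1 := by
        have : (16 * τ ^ 2) ^ p = 16 ^ p * τ ^ (2 * p) := by
          rw [Real.mul_rpow (by norm_num) (by positivity), Real.rpow_mul hτ0.le, Real.rpow_two]
        rw [mul_assoc, ← this, hl, Real.rpow_neg (by positivity),
          inv_mul_cancel₀ (by positivity)]
      have e3 : (16 : ℝ) ^ (2 * p) = (16 ^ p) ^ 2 := by
        rw [mul_comm, Real.rpow_mul (by norm_num), Real.rpow_two]
      rw [hQ, secondMomentBound, deviationConst, e1, e3]
      calc _ = 16 * (2 * p) ^ p * τ ^ (2 * p) * τ ^ 2 * 1 ^ 2 := by ring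
        _ = _ := by rw [← e2]; ring
    calc m * (c ^ 2 * Q - c * (ε * l)) ≤ m * -(c * (ε * l) / 2) := by gcongr
      _ = -(ε ^ 2 * (m * w) * l ^ 2 / (4 * Q * τ ^ 2)) := by rw [hc]; field_simp; ring
      _ = _ := by
        have := deviationConst_pos hp
        rw [h2, hmw]; field_simp
  have hcB : ∀ y : ℝ, |y| ≤ B → c * |y| ^ p ≤ (1 + y ^ 2) / (2 * τ ^ 2) := fun y hy => by
    calc c * |y| ^ p ≤ c * ((1 + y ^ 2) * B ^ (r - 2)) := by
          gcongr
          exact rpow_le_one_add_sq_mul (by linarith) (le_max_left _ _) hr2 hB1 hy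
      _ = (w * B ^ (r - 2)) * ((1 + y ^ 2) / (2 * τ ^ 2)) * (ε * l / Q) := by
          rw [hc]; field_simp
      _ = (1 + y ^ 2) / (2 * τ ^ 2) * (ε * l / Q) := by rw [hwB, one_mul]
      _ ≤ _ := by
          refine mul_le_of_le_one_right (by positivity) ?_
          rw [div_le_one (by linarith)]
          nlinarith
  have hlow := measureReal_sum_rpow_le hY hind (by linarith) hv hc0.le (ε * l)
  have hup := measureReal_le_sum_rpow hY hind (by linarith) hτ hv hc0.le (by linarith) hcB (ε * l)
  rw [← hm, ← hQ] at hlow hup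
  have hsub : {ω | ¬ (m * (v - ε * l) < ∑ i, |Y i ω| ^ p ∧ ∑ i, |Y i ω| ^ p < m * (v + ε * l))}
      ⊆ {ω | ∑ i, |Y i ω| ^ p ≤ m * (v - ε * l)} ∪ {ω | m * (v + ε * l) ≤ ∑ i, |Y i ω| ^ p} := by
    intro ω hω
    have hω' : ¬ (m * (v - ε * l) < ∑ i, |Y i ω| ^ p ∧ ∑ i, |Y i ω| ^ p < m * (v + ε * l)) := hω
    rw [not_and_or, not_lt, not_lt] at hω'
    exact hω'
  have hE := Real.exp_le_exp.2 hexp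
  rw [hB2] at hup
  refine (measureReal_mono hsub).trans ((measureReal_union_le _ _).trans ?_)
  linarith

/-! ### Moments of normalised sub-Gaussian variables -/

namespace HasSqExpBound

variable {Ω : Type*} [MeasurableSpace Ω] {P : Measure Ω} {Y : Ω → ℝ} {τ p : ℝ}

/-- A variable of unit second moment has first absolute moment bounded below. -/
lemma le_integral_abs (h : HasSqExpBound Y τ P) (h2 : ∫ ω, Y ω ^ 2 ∂P = 1) :
    1 / (16 * τ ^ 2) ≤ ∫ ω, |Y ω| ∂P := by
  have hτ := h.pos
  have h1i : Integrable (fun ω => |Y ω|) P := by simpa using h.integrable_rpow one_pos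
  have h4i : Integrable (fun ω => Y ω ^ 4) P := by
    have := h.integrable_rpow (s := (4 : ℕ)) (by norm_num)
    simp only [Real.rpow_natCast] at this
    refine this.congr (ae_of_all _ fun ω => ?_)
    exact Even.pow_abs (by decide) _
  have h4 : ∫ ω, Y ω ^ 4 ∂P ≤ 32 * τ ^ 4 := by
    have h5 := h.integral_rpow_le (s := (4 : ℕ)) (by norm_num)
    have h6 : ∀ ω, |Y ω| ^ ((4 : ℕ) : ℝ) = Y ω ^ 4 := fun ω => by
      rw [Real.rpow_natCast]; exact Even.pow_abs (by decide) _
    simp only [h6] at h5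
    refine h5.trans (le_of_eq ?_)
    rw [Real.rpow_natCast, show ((4 : ℕ) : ℝ) / 2 = (2 : ℕ) by norm_num, Real.rpow_natCast]
    norm_num
    ring
  -- Splitting at `|y| = a` gives `y² ≤ a|y| + y⁴/a²`; this `a` makes the fourth-moment term at most
  -- `1/2`.
  set a := 8 * τ ^ 2 with ha
  have ha0 : 0 < a := by positivity
  have hpt : ∀ y : ℝ, y ^ 2 ≤ a * |y| + y ^ 4 / a ^ 2 := fun y => by
    have hy : 0 ≤ |y| := abs_nonneg y
    rw [← sq_abs, show y ^ 4 = |y| ^ 4 from (Even.pow_abs (by decide) _).symm]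
    rcases le_total |y| a with hle | hle
    · have : 0 ≤ |y| ^ 4 / a ^ 2 := by positivity
      nlinarith
    · have : |y| ^ 2 ≤ |y| ^ 4 / a ^ 2 := by
        rw [le_div_iff₀ (by positivity)]
        calc |y| ^ 2 * a ^ 2 ≤ |y| ^ 2 * |y| ^ 2 := by gcongr
          _ = _ := by ring
      have : 0 ≤ a * |y| := by positivity
      linarith
  have hint : ∫ ω, Y ω ^ 2 ∂P ≤ a * ∫ ω, |Y ω| ∂P + (∫ ω, Y ω ^ 4 ∂P) / a ^ 2 := by
    rw [← integral_const_mul, ← integral_div, ← integral_add (h1i.const_mul _) (h4i.div_const _)]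
    exact integral_mono h.integrable_sq ((h1i.const_mul _).add (h4i.div_const _)) fun ω => hpt _
  have h7 : (∫ ω, Y ω ^ 4 ∂P) / a ^ 2 ≤ 1 / 2 := by
    rw [div_le_iff₀ (by positivity), ha]
    linarith [h4, show (1 / 2 : ℝ) * (8 * τ ^ 2) ^ 2 = 32 * τ ^ 4 by ring]
  rw [h2] at hint
  rw [div_le_iff₀ (by positivity)]
  linarith [show (∫ ω, |Y ω| ∂P) * (16 * τ ^ 2) = 2 * (a * ∫ ω, |Y ω| ∂P) by rw [ha]; ring]

lemma eLpNorm_eq (h : HasSqExpBound Y τ P) (hp : 0 < p) :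
    eLpNorm Y (ENNReal.ofReal p) P = ENNReal.ofReal ((∫ ω, |Y ω| ^ p ∂P) ^ (1 / p)) := by
  rw [(h.memLp hp).eLpNorm_eq_integral_rpow_norm (by simpa using hp) (by simp)]
  simp [ENNReal.toReal_ofReal hp.le]

/-- The `p`-th absolute moments of a random variable are monotone in `p`. -/
lemma rpow_integral_rpow_mono [IsProbabilityMeasure P] (h : HasSqExpBound Y τ P) {q : ℝ} (hp : 0 < p) (hpq : p ≤ q) :
    (∫ ω, |Y ω| ^ p ∂P) ^ (1 / p) ≤ (∫ ω, |Y ω| ^ q ∂P) ^ (1 / q) := by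
  have h1 := eLpNorm_le_eLpNorm_of_exponent_le (μ := P) (ENNReal.ofReal_le_ofReal hpq)
    h.measurable.aestronglyMeasurable
  rw [h.eLpNorm_eq hp, h.eLpNorm_eq (hp.trans_le hpq)] at h1
  exact (ENNReal.ofReal_le_ofReal_iff
    (Real.rpow_nonneg (integral_nonneg fun ω => by positivity) _)).1 h1

lemma le_rpow_integral_rpow [IsProbabilityMeasure P] (h : HasSqExpBound Y τ P) (h2 : ∫ ω, Y ω ^ 2 ∂P = 1) (hp : 1 ≤ p) :
    1 / (16 * τ ^ 2) ≤ (∫ ω, |Y ω| ^ p ∂P) ^ (1 / p) := by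
  have h1 := h.rpow_integral_rpow_mono one_pos hp
  simp only [Real.rpow_one, div_one] at h1
  exact (h.le_integral_abs h2).trans h1

lemma one_le_rpow_integral_rpow [IsProbabilityMeasure P] (h : HasSqExpBound Y τ P) (h2 : ∫ ω, Y ω ^ 2 ∂P = 1)
    (hp : 2 ≤ p) : 1 ≤ (∫ ω, |Y ω| ^ p ∂P) ^ (1 / p) := by
  have h1 := h.rpow_integral_rpow_mono two_pos hp
  simpa [h2] using h1

lemma rpow_integral_rpow_le_one [IsProbabilityMeasure P] (h : HasSqExpBound Y τ P) (h2 : ∫ ω, Y ω ^ 2 ∂P = 1)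
    (hp : 0 < p) (hp2 : p ≤ 2) : (∫ ω, |Y ω| ^ p ∂P) ^ (1 / p) ≤ 1 := by
  have h1 := h.rpow_integral_rpow_mono hp hp2
  simpa [h2] using h1

lemma rpow_integral_rpow_le (h : HasSqExpBound Y τ P) (hp : 0 < p) :
    (∫ ω, |Y ω| ^ p ∂P) ^ (1 / p) ≤ (2 * p ^ (p / 2)) ^ (1 / p) * τ := by
  have hτ := h.pos
  calc (∫ ω, |Y ω| ^ p ∂P) ^ (1 / p) ≤ (2 * (p ^ (p / 2) * τ ^ p)) ^ (1 / p) :=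
        Real.rpow_le_rpow (integral_nonneg fun ω => by positivity) (h.integral_rpow_le hp)
          (by positivity)
    _ = _ := by
        rw [← mul_assoc, Real.mul_rpow (by positivity) (by positivity), ← Real.rpow_mul hτ.le,
          mul_one_div_cancel hp.ne', Real.rpow_one]

end HasSqExpBound

/-! ### Rows of a sub-Gaussian ensemble -/

lemma hasSqExpBound_of_orliczNorm_lt {Ω : Type*} [MeasurableSpace Ω] {P : Measure Ω}
    {X : Ω → ℝ} (hX : Measurable X) {s : ℝ} (h : orliczNorm 2 X P < ENNReal.ofReal s) :
    HasSqExpBound X s P := by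
  simp only [orliczNorm, iInf_lt_iff] at h
  obtain ⟨t, ht, hle, hts⟩ := h
  have hts' : t < s := (ENNReal.ofReal_lt_ofReal_iff_of_nonneg ht.le).1 hts
  refine .of_lintegral_le hX (ht.trans hts') ((lintegral_mono fun ω => ?_).trans hle)
  refine ENNReal.ofReal_le_ofReal (Real.exp_le_exp.2 ?_)
  rw [Real.rpow_two, Real.rpow_two, sq_abs]
  gcongr

lemma one_le_orliczNorm_two {Ω : Type*} [MeasurableSpace Ω] {P : Measure Ω}
    [IsProbabilityMeasure P] {X : Ω → ℝ} (hX : Measurable X) (h2 : ∫ ω, X ω ^ 2 ∂P = 1) :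
    1 ≤ orliczNorm 2 X P := by
  refine le_iInf fun t => le_iInf fun ht => le_iInf fun hle => ?_
  rw [ENNReal.one_le_ofReal]
  refine HasSqExpBound.one_le_of_integral_sq (.of_lintegral_le hX ht ?_) h2
  simpa only [Real.rpow_two, sq_abs] using hle

/-- The rows of a matrix with independent entries are independent. -/
lemma ProbabilityTheory.iIndepFun.curry {Ω ι κ E : Type*} [MeasurableSpace Ω] [MeasurableSpace E]
    {P : Measure Ω} {X : ι → κ → Ω → E} (hX : ∀ i j, Measurable (X i j))
    (h : iIndepFun (fun (ij : ι × κ) ω => X ij.1 ij.2 ω) P) :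
    iIndepFun (fun i ω => (fun j => X i j ω)) P := by
  have := h.isProbabilityMeasure
  have hP : ∀ i j, IsProbabilityMeasure (P.map (X i j)) :=
    fun i j => Measure.isProbabilityMeasure_map (hX i j).aemeasurable
  have hrow : ∀ i, iIndepFun (X i) P := fun i =>
    h.precomp (g := fun j => (i, j)) fun _ _ hj => (Prod.mk.inj hj).2
  have hmap := (iIndepFun_iff_map_fun_eq_infinitePi_map
    (fun ij : ι × κ => hX ij.1 ij.2)).1 h
  have hcomp : (MeasurableEquiv.curry ι κ E) ∘ (fun ω (ij : ι × κ) => X ij.1 ij.2 ω)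
      = fun ω i j => X i j ω := rfl
  -- The joint law of the entries is a product measure; currying regroups it as a product of the row
  -- laws.
  rw [iIndepFun_iff_map_fun_eq_infinitePi_map (by fun_prop), ← hcomp,
    ← Measure.map_map (by fun_prop) (by fun_prop), hmap,
    Measure.infinitePi_map_curry (fun i j => P.map (X i j))]
  congr 1
  funext i
  rw [(iIndepFun_iff_map_fun_eq_infinitePi_map (hX i)).1 (hrow i)]

namespace IsSubGaussianEnsemble

variable {Ω : Type*} [MeasurableSpace Ω] {P : Measure Ω} {m n : ℕ} {A : Ω → Matrix (Fin m) (Fin n) ℝ}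

lemma integral_entry_sq (hA : IsSubGaussianEnsemble A P) (i : Fin m) (j : Fin n) :
    ∫ ω, A ω i j ^ 2 ∂P = 1 := by
  rw [← hA.unit_variance i j, variance_of_integral_eq_zero (hA.measurable_entry i j).aemeasurable
    (hA.mean_zero i j)]

lemma one_le_toReal_orliczNorm [IsProbabilityMeasure P] (hA : IsSubGaussianEnsemble A P) (i : Fin m) (j : Fin n) :
    1 ≤ (orliczNorm 2 (fun ω => A ω i j) P).toReal := by
  have h := one_le_orliczNorm_two (hA.measurable_entry i j) (hA.integral_entry_sq i j)
  simpa using ENNReal.toReal_mono (hA.subGaussian i j).ne h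

/-- Since `K < 2K`, some admissible scale lies below `2K`, so attainment of the infimum is not
needed. -/
lemma hasSqExpBound_entry [IsProbabilityMeasure P] (hA : IsSubGaussianEnsemble A P) (i i' : Fin m) (j j' : Fin n) :
    HasSqExpBound (fun ω => A ω i j)
      (2 * (orliczNorm 2 (fun ω => A ω i' j') P).toReal) P := by
  have h1 := hA.one_le_toReal_orliczNorm i' j'
  have h : HasSqExpBound (fun ω => A ω i' j')
      (2 * (orliczNorm 2 (fun ω => A ω i' j') P).toReal) P := by
    refine hasSqExpBound_of_orliczNorm_lt (hA.measurable_entry i' j') ?_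
    conv_lhs => rw [← ENNReal.ofReal_toReal (hA.subGaussian i' j').ne]
    exact (ENNReal.ofReal_lt_ofReal_iff (by linarith)).2 (by linarith)
  have hid := (hA.identDistrib i j i' j').comp
    (u := fun x => Real.exp (x ^ 2 / (2 * (orliczNorm 2 (fun ω => A ω i' j') P).toReal) ^ 2))
    (by fun_prop)
  exact ⟨hA.measurable_entry i j, h.pos, hid.integrable_iff.2 h.integrable_exp,
    hid.integral_eq.le.trans h.integral_exp_le⟩

lemma measurable_mulVec (hA : IsSubGaussianEnsemble A P) (u : Fin n → ℝ) (i : Fin m) :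
    Measurable fun ω => (A ω *ᵥ u) i := by
  have := hA.measurable_entry
  simp only [Matrix.mulVec, dotProduct]
  fun_prop

/-- A unit linear combination of a row has a bounded square-exponential moment. -/
lemma hasSqExpBound_mulVec [IsProbabilityMeasure P] (hA : IsSubGaussianEnsemble A P) (i i' : Fin m) (j' : Fin n)
    {u : EuclideanSpace ℝ (Fin n)} (hu : ‖u‖ = 1) :
    HasSqExpBound (fun ω => (A ω *ᵥ u.ofLp) i)
      (12 * (orliczNorm 2 (fun ω => A ω i' j') P).toReal) P := by
  set K := (orliczNorm 2 (fun ω => A ω i' j') P).toReal with hK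
  have hK1 : 1 ≤ K := hA.one_le_toReal_orliczNorm i' j'
  have hrow : iIndepFun (fun j ω => u j * A ω i j) P :=
    (hA.indep.precomp (g := fun j => (i, j)) fun _ _ hj => (Prod.mk.inj hj).2).comp
      (fun j x => u j * x) fun j => by fun_prop
  -- Scale `2K` gives each entry the variance proxy `9(2K)² = (6K)²`. Weighted by `u j ^ 2` these
  -- sum to `(6K)²`, and the return to square-exponential form doubles `6K` to `12K`.
  have hsum := HasSubgaussianMGF.sum_of_iIndepFun hrow (s := Finset.univ)
    (c := fun j => Real.toNNReal (u j ^ 2 * (6 * K) ^ 2)) fun j _ => by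
      have h := ((hA.hasSqExpBound_entry i i' j j').hasSubgaussianMGF
        (hA.mean_zero i j)).const_mul (u j)
      convert h
      refine NNReal.eq ?_
      rw [Real.coe_toNNReal _ (by positivity)]
      change _ = u j ^ 2 * (9 * (2 * K) ^ 2)
      ring
  have hY : (fun ω => ∑ j, u j * A ω i j) = fun ω => (A ω *ᵥ u.ofLp) i := by
    funext ω
    simp only [Matrix.mulVec, dotProduct, mul_comm]
  rw [hY] at hsum
  have hu2 : ∑ j, u j ^ 2 = 1 := by
    have := EuclideanSpace.real_norm_sq_eq u
    rw [hu] at this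
    linarith
  have hc : ((∑ j, Real.toNNReal (u j ^ 2 * (6 * K) ^ 2) : NNReal) : ℝ) = (6 * K) ^ 2 := by
    rw [NNReal.coe_sum, Finset.sum_congr rfl fun j _ => Real.coe_toNNReal _ (by positivity),
      ← Finset.sum_mul, hu2, one_mul]
  have h := hsum.hasSqExpBound (hA.measurable_mulVec _ i) (by
    rw [← NNReal.coe_pos, hc]; positivity)
  rw [hc, Real.sqrt_sq (by positivity)] at h
  convert h using 1
  ring

/-- Isotropy: the variances of the independent centred terms add up to `∑ u j ^ 2 = 1`. -/
lemma integral_mulVec_sq [IsProbabilityMeasure P] (hA : IsSubGaussianEnsemble A P) (i : Fin m)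
    {u : EuclideanSpace ℝ (Fin n)} (hu : ‖u‖ = 1) :
    ∫ ω, (A ω *ᵥ u.ofLp) i ^ 2 ∂P = 1 := by
  have hL : ∀ j, MemLp (fun ω => A ω i j) 2 P := fun j => by
    simpa using (hA.hasSqExpBound_entry i i j j).memLp (s := 2) (by norm_num)
  have hrow : iIndepFun (fun j ω => u j * A ω i j) P :=
    (hA.indep.precomp (g := fun j => (i, j)) fun _ _ hj => (Prod.mk.inj hj).2).comp
      (fun j x => u j * x) fun j => by fun_prop
  have hY : (∑ j, fun ω => u j * A ω i j) = fun ω => (A ω *ᵥ u.ofLp) i := by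
    funext ω
    simp only [Matrix.mulVec, dotProduct, mul_comm, Finset.sum_apply]
  have hmean : ∫ ω, (A ω *ᵥ u.ofLp) i ∂P = 0 := by
    simp only [Matrix.mulVec, dotProduct]
    rw [integral_finsetSum _ fun j _ => ((hL j).integrable one_le_two).mul_const _]
    simp [integral_mul_const, hA.mean_zero]
  rw [← variance_of_integral_eq_zero (hA.measurable_mulVec _ i).aemeasurable hmean, ← hY,
    IndepFun.variance_sum (fun j _ => (hL j).const_mul (u j))
      (fun j _ k _ hjk => hrow.indepFun hjk)]
  simp only [variance_const_mul, hA.unit_variance, mul_one]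
  have := EuclideanSpace.real_norm_sq_eq u
  rw [hu] at this
  linarith

lemma iIndepFun_mulVec (hA : IsSubGaussianEnsemble A P) (u : Fin n → ℝ) :
    iIndepFun (fun i ω => (A ω *ᵥ u) i) P :=
  (iIndepFun.curry hA.measurable_entry hA.indep).comp
    (fun _ row => ∑ j, row j * u j) fun _ => by fun_prop

lemma identDistrib_mulVec (hA : IsSubGaussianEnsemble A P) (u : Fin n → ℝ) (i i' : Fin m) :
    IdentDistrib (fun ω => (A ω *ᵥ u) i) (fun ω => (A ω *ᵥ u) i') P P :=
  (IdentDistrib.pi (fun j => hA.identDistrib i j i' j)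
    (hA.indep.precomp (g := fun j => (i, j)) fun _ _ hj => (Prod.mk.inj hj).2)
    (hA.indep.precomp (g := fun j => (i', j)) fun _ _ hj => (Prod.mk.inj hj).2)).comp
    (u := fun row : Fin n → ℝ => ∑ j, row j * u j) (by fun_prop)

end IsSubGaussianEnsemble

/-! ### Normalised `ℓ_p` norms -/

lemma two_mul_betaExp (p : ℝ) : 2 * betaExp p = 2 / max p 2 := by
  unfold betaExp
  split_ifs with h
  · rw [max_eq_right h]; norm_num
  · rw [max_eq_left (not_le.1 h).le]; ring

lemma vecLpNorm_normalized {m : ℕ} {p : ℝ} (hp : 0 < p) (z : Fin m → ℝ) :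
    vecLpNorm p ((1 / (m : ℝ) ^ (1 / p)) • z) = ((∑ i, |z i| ^ p) / m) ^ (1 / p) := by
  unfold vecLpNorm
  congr 1
  rw [Finset.sum_div]
  refine Finset.sum_congr rfl fun i _ => ?_
  rw [Pi.smul_apply, smul_eq_mul, abs_mul, Real.mul_rpow (abs_nonneg _) (abs_nonneg _),
    abs_of_nonneg (by positivity), Real.div_rpow (by positivity) (by positivity),
    ← Real.rpow_mul (by positivity), one_div_mul_cancel hp.ne', Real.rpow_one, Real.one_rpow]
  ring

lemma vecLpNorm_smul {m : ℕ} {p : ℝ} (hp : 0 < p) {c : ℝ} (hc : 0 ≤ c) (z : Fin m → ℝ) :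
    vecLpNorm p (c • z) = c * vecLpNorm p z := by
  unfold vecLpNorm
  have h : ∀ i, |(c • z) i| ^ p = c ^ p * |z i| ^ p := fun i => by
    rw [Pi.smul_apply, smul_eq_mul, abs_mul, abs_of_nonneg hc, Real.mul_rpow hc (abs_nonneg _)]
  simp only [h]
  rw [← Finset.mul_sum, Real.mul_rpow (by positivity) (by positivity), ← Real.rpow_mul hc,
    mul_one_div_cancel hp.ne', Real.rpow_one]

/-- A small relative deviation of the mean of `|zᵢ|^p` gives one of the normalised `ℓ_p` norm. -/
lemma vecLpNorm_normalized_mem {m : ℕ} [NeZero m] {p μ ε l : ℝ} (hp : 1 ≤ p) (hμ : 0 ≤ μ)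
    (hε : 0 < ε) (hε1 : ε < 1) (hl : l ≤ μ ^ p) {z : Fin m → ℝ}
    (h1 : m * (μ ^ p - ε * l) < ∑ i, |z i| ^ p) (h2 : ∑ i, |z i| ^ p < m * (μ ^ p + ε * l)) :
    (1 - ε) * μ ≤ vecLpNorm p ((1 / (m : ℝ) ^ (1 / p)) • z) ∧
      vecLpNorm p ((1 / (m : ℝ) ^ (1 / p)) • z) ≤ (1 + ε) * μ := by
  have hp0 : 0 < p := by linarith
  have hm : (0 : ℝ) < m := Nat.cast_pos.2 (NeZero.pos m)
  have hεl : ε * l ≤ ε * μ ^ p := by gcongr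
  have hμp : 0 ≤ μ ^ p := by positivity
  rw [vecLpNorm_normalized hp0, one_div p]
  constructor
  · rw [Real.le_rpow_inv_iff_of_pos (by nlinarith) (by positivity) hp0,
      le_div_iff₀ hm, Real.mul_rpow (by linarith) hμ]
    -- As `p ≥ 1`, taking `p`-th roots only shrinks a relative deviation, so `ε` is kept without
    -- loss.
    have h3 : (1 - ε) ^ p ≤ 1 - ε := by
      simpa using Real.rpow_le_rpow_of_exponent_ge (x := 1 - ε) (by linarith) (by linarith) hp
    calc (1 - ε) ^ p * μ ^ p * m ≤ (1 - ε) * μ ^ p * m := by gcongr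
      _ = m * (μ ^ p - ε * μ ^ p) := by ring
      _ ≤ m * (μ ^ p - ε * l) := by gcongr
      _ ≤ _ := h1.le
  · rw [Real.rpow_inv_le_iff_of_pos (by positivity) (by positivity) hp0,
      div_le_iff₀ hm, Real.mul_rpow (by linarith) hμ]
    have h3 : 1 + ε ≤ (1 + ε) ^ p := by
      simpa using Real.rpow_le_rpow_of_exponent_le (x := 1 + ε) (by linarith) hp
    calc ∑ i, |z i| ^ p ≤ m * (μ ^ p + ε * l) := h2.le
      _ ≤ m * (μ ^ p + ε * μ ^ p) := by gcongr
      _ = (1 + ε) * μ ^ p * m := by ring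
      _ ≤ _ := by gcongr

/-! ### The union bound -/

/-- The `p`-dependent constant in the exponent of the concentration inequality. -/
noncomputable def concentrationConst (p : ℝ) : ℝ :=
  (6 + 4 * (288 * max p 2) ^ max p 2) / min (1 / (deviationConst p * 12 ^ (6 * p + 2))) (1 / 288)

lemma concentrationConst_pos {p : ℝ} (hp : 1 ≤ p) : 0 < concentrationConst p := by
  have := deviationConst_pos hp
  have : 0 < max p 2 := by positivity
  unfold concentrationConst
  have : 0 < min (1 / (deviationConst p * 12 ^ (6 * p + 2))) (1 / 288) :=
    lt_min (by positivity) (by norm_num)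
  positivity

/-- The assumption `hs` is the nontrivial regime. It forces `G = ε² m^(2/r) / K^(8p+8)` to dominate
both `log N` and 1, so a fixed multiple of `G` can absorb both `N²` and `m`. -/
lemma union_bound_le {p K d ε m N : ℝ} (hp : 1 ≤ p) (hK : 1 ≤ K) (hd : 0 < d) (hd1 : d ≤ 1)
    (hε : 0 < ε) (hε1 : ε < 1) (hm : 1 ≤ m) (hN : 2 ≤ N)
    (hs : Real.log 2 < ε ^ 2 * m ^ (2 / max p 2) /
      (d ^ (-2 : ℝ) * concentrationConst p * K ^ (8 * p + 8) * Real.log N)) :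
    N ^ 2 * (2 * Real.exp (-(ε ^ 2 * m ^ (2 / max p 2)
          / (deviationConst p * (12 * K) ^ (6 * p + 2))))
        + 2 * m * Real.exp (-(m ^ (2 / max p 2) / (12 * K) ^ 2)))
      ≤ 2 * Real.exp (-(ε ^ 2 * m ^ (2 / max p 2) /
        (d ^ (-2 : ℝ) * concentrationConst p * K ^ (8 * p + 8) * Real.log N))) := by
  have hC0 := concentrationConst_pos hp
  have ha0 := deviationConst_pos hp
  set r := max p 2 with hr
  have hr2 : 2 ≤ r := le_max_right _ _
  have hr0 : 0 < r := by linarith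
  have hm0 : 0 < m := by linarith
  have hK0 : 0 < K := by linarith
  set x := m ^ (2 / r) with hx
  have hx0 : 0 < x := by positivity
  set C := concentrationConst p with hC
  set L := Real.log N with hL
  set R := (288 * r) ^ r with hR
  have hR0 : 0 < R := by positivity
  set c := min (1 / (deviationConst p * 12 ^ (6 * p + 2))) (1 / 288) with hc
  have hc0 : 0 < c := lt_min (by positivity) (by norm_num)
  have hc1 : c ≤ 1 / (deviationConst p * 12 ^ (6 * p + 2)) := min_le_left _ _
  have hc2 : c ≤ 1 / 288 := min_le_right _ _
  have hCc : C * c = 6 + 4 * R := by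
    rw [hC, concentrationConst]
    exact div_mul_cancel₀ _ hc0.ne'
  have hlog2 : 1 / 2 < Real.log 2 := by linarith [Real.log_two_gt_d9]
  have hL2 : 1 / 2 < L := hlog2.trans_le (Real.log_le_log (by norm_num) hN)
  have hL0 : 0 < L := by linarith
  set s := ε ^ 2 * x / (d ^ (-2 : ℝ) * C * K ^ (8 * p + 8) * L) with hsdef
  set G := ε ^ 2 * x / K ^ (8 * p + 8) with hG
  have hG0 : 0 < G := by positivity
  have hC6 : 6 ≤ C := by nlinarith
  have hsG : s * (C * L) ≤ G := by
    have hd2 : 1 ≤ d ^ (-2 : ℝ) :=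
      Real.one_le_rpow_of_pos_of_le_one_of_nonpos hd hd1 (by norm_num)
    have h1 : s * (C * L) = G / d ^ (-2 : ℝ) := by rw [hsdef, hG]; field_simp
    rw [h1]
    exact div_le_self hG0.le hd2
  have hCL : 0 < C * L := by positivity
  have hGL : C * L ≤ 2 * G := by nlinarith
  have hG1 : 1 ≤ G := by nlinarith
  have hKx : K ^ (8 * p + 8) ≤ ε ^ 2 * x := (one_le_div (by positivity)).1 hG1
  have hεx : ε ^ 2 * x ≤ x := mul_le_of_le_one_left hx0.le (by nlinarith)
  have hKpow : ∀ q : ℝ, q ≤ 8 * p + 8 → K ^ q ≤ K ^ (8 * p + 8) := fun q hq =>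
    Real.rpow_le_rpow_of_exponent_le hK hq
  have hE1 : c * G ≤ ε ^ 2 * x / (deviationConst p * (12 * K) ^ (6 * p + 2)) := by
    rw [Real.mul_rpow (by norm_num) hK0.le]
    calc c * G ≤ 1 / (deviationConst p * 12 ^ (6 * p + 2)) * (ε ^ 2 * x / K ^ (6 * p + 2)) := by
          rw [hG]
          have := hKpow (6 * p + 2) (by linarith)
          gcongr
      _ = _ := by field_simp
  set w := x / K ^ 2 with hw
  have hw0 : 0 < w := by positivity
  have hGw : G ≤ w := by
    have := hKpow (2 : ℕ) (by norm_num; linarith)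
    rw [Real.rpow_natCast] at this
    rw [hG, hw]
    gcongr
  have hxw : x ≤ w ^ 2 := by
    have h4 := hKpow (4 : ℕ) (by norm_num; linarith)
    rw [Real.rpow_natCast] at h4
    rw [hw, div_pow, le_div_iff₀ (by positivity), sq x, show (K ^ 2) ^ 2 = K ^ 4 by ring]
    exact mul_le_mul_of_nonneg_left (h4.trans (hKx.trans hεx)) hx0.le
  -- Since `x ≤ w²`, `m` is at most `w^r`. With `288 = 2 * 12²`, half of the exponent `x / (12K)² =
  -- w / 144` pays for it.
  have hmR : m ≤ R * Real.exp (w / 288) := by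
    have h1 : m = x ^ (r / 2) := by
      rw [hx, ← Real.rpow_mul hm0.le, show 2 / r * (r / 2) = 1 by field_simp, Real.rpow_one]
    have h2 : (w ^ 2) ^ (r / 2) = w ^ r := by
      rw [← Real.rpow_natCast, ← Real.rpow_mul hw0.le,
        show ((2 : ℕ) : ℝ) * (r / 2) = r by push_cast; ring]
    have h3 := rpow_le_mul_exp (t := w) (s := r) (c := 1 / 288) hw0.le hr0 (by norm_num)
    rw [show r / (1 / 288) = 288 * r by ring, one_div_mul_eq_div] at h3
    calc m ≤ (w ^ 2) ^ (r / 2) := by rw [h1]; gcongr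
      _ = w ^ r := h2
      _ ≤ _ := h3
  have hE2 : m * Real.exp (-(x / (12 * K) ^ 2)) ≤ R * Real.exp (-(c * G)) := by
    calc m * Real.exp (-(x / (12 * K) ^ 2))
        ≤ R * Real.exp (w / 288) * Real.exp (-(x / (12 * K) ^ 2)) := by gcongr
      _ = R * Real.exp (-(w / 288)) := by
          rw [mul_assoc, ← Real.exp_add]
          congr 2
          rw [hw, mul_pow]; field_simp; ring
      _ ≤ R * Real.exp (-(c * G)) := by
          gcongr
          calc c * G ≤ 1 / 288 * w := by gcongr
            _ = _ := by ring
  have hNL : N ^ 2 = Real.exp (2 * L) := by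
    rw [two_mul, Real.exp_add, hL, Real.exp_log (by linarith)]; ring
  -- Both `s` and `L` exceed `1/2` and `s * C * L ≤ G`, so each is at most `2G/C`, and `R ≤ 2R *
  -- (2G/C)`. The total `(6 + 4R) G / C` is exactly `c * G`, which dictates `concentrationConst`.
  have hfin : 2 * L + R + s ≤ c * G := by
    have h1 : s ≤ 2 * G / C := by
      rw [le_div_iff₀ hC0]
      have hs0 : 0 < s := by linarith
      have : s * (C * (1 / 2)) ≤ s * (C * L) := by gcongr
      linarith
    have h2 : L ≤ 2 * G / C := by rw [le_div_iff₀ hC0]; linarith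
    have h3 : R ≤ 2 * R * (2 * G / C) := by
      have : R * (1 / 2) ≤ R * (2 * G / C) :=
        mul_le_mul_of_nonneg_left (hL2.le.trans h2) hR0.le
      linarith
    have h4 : c * G = (6 + 4 * R) * G / C := by rw [← hCc]; field_simp
    have h5 : (6 + 4 * R) * G / C = (3 + 2 * R) * (2 * G / C) := by ring
    rw [h4, h5]
    linarith
  calc _ ≤ N ^ 2 * (2 * Real.exp (-(c * G)) + 2 * (R * Real.exp (-(c * G)))) := by
        rw [mul_assoc 2 m]
        gcongr
    _ = 2 * (Real.exp (2 * L) * (R + 1) * Real.exp (-(c * G))) := by rw [hNL]; ring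
    _ ≤ 2 * (Real.exp (2 * L) * Real.exp R * Real.exp (-(c * G))) := by
        gcongr; exact Real.add_one_le_exp R
    _ = 2 * Real.exp (2 * L + R - c * G) := by rw [← Real.exp_add, ← Real.exp_add]; rfl
    _ ≤ 2 * Real.exp (-s) := by gcongr; linarith

lemma lowerConst_pos {C p K : ℝ} (hC : 0 < C) (hK : 0 < K) : 0 < lowerConst C p K := by
  unfold lowerConst; split_ifs <;> positivity

lemma lowerConst_le_one {C p K : ℝ} (hC1 : C ≤ 1) (hK : 1 ≤ K) :
    lowerConst C p K ≤ 1 := by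
  unfold lowerConst
  split_ifs
  · exact mul_le_one₀ hC1 (by positivity)
      (Real.rpow_le_one_of_one_le_of_nonpos hK (by norm_num))
  · exact le_rfl

namespace HasSqExpBound

variable {Ω : Type*} [MeasurableSpace Ω] {P : Measure Ω} [IsProbabilityMeasure P]
  {Y : Ω → ℝ} {K p : ℝ}

/-- Here `2304 = 16 * 12²`. For `p < 2` the argument yields `K⁻²`, which is weakened to `K⁻³` using
`K ≥ 1`. -/
lemma lowerConst_le (h : HasSqExpBound Y (12 * K) P) (h2 : ∫ ω, Y ω ^ 2 ∂P = 1) (hp : 1 ≤ p)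
    (hK : 1 ≤ K) : lowerConst (1 / 2304) p K ≤ (∫ ω, |Y ω| ^ p ∂P) ^ (1 / p) := by
  unfold lowerConst
  split_ifs with hp2
  · refine le_trans ?_ (h.le_rpow_integral_rpow h2 hp)
    have h3 : K ^ (-3 : ℝ) ≤ K ^ (-2 : ℝ) := Real.rpow_le_rpow_of_exponent_le hK (by norm_num)
    have h4 : K ^ (-2 : ℝ) = (K ^ 2)⁻¹ := by rw [Real.rpow_neg (by linarith), Real.rpow_two]
    calc 1 / 2304 * K ^ (-3 : ℝ) ≤ 1 / 2304 * (K ^ 2)⁻¹ := by rw [← h4]; gcongr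
      _ = _ := by field_simp; norm_num
  · exact h.one_le_rpow_integral_rpow h2 (not_lt.1 hp2)

lemma le_upperConst (h : HasSqExpBound Y (12 * K) P) (h2 : ∫ ω, Y ω ^ 2 ∂P = 1) (hp : 1 ≤ p) :
    (∫ ω, |Y ω| ^ p ∂P) ^ (1 / p) ≤ upperConst (12 * (2 * p ^ (p / 2)) ^ (1 / p)) p K := by
  unfold upperConst
  split_ifs with hp2
  · exact h.rpow_integral_rpow_le_one h2 (by linarith) hp2
  · exact (h.rpow_integral_rpow_le (by linarith)).trans_eq (by ring)

end HasSqExpBound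

namespace IsSubGaussianEnsemble

variable {Ω : Type*} [MeasurableSpace Ω] {P : Measure Ω} [IsProbabilityMeasure P] {m n : ℕ}
  [NeZero m] {A : Ω → Matrix (Fin m) (Fin n) ℝ} {p K : ℝ}

/-- Concentration of the normalised `ℓ_p` norm of the image of a unit vector. -/
lemma measureReal_vecLpNorm_deviation_le (hA : IsSubGaussianEnsemble A P)
    {u : EuclideanSpace ℝ (Fin n)} (hu : ‖u‖ = 1) (hp : 1 ≤ p) (hK : 1 ≤ K)
    (hY : ∀ i, HasSqExpBound (fun ω => (A ω *ᵥ u.ofLp) i) (12 * K) P) {ε : ℝ} (hε : 0 < ε)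
    (hε1 : ε < 1) :
    P.real {ω | ¬ ((1 - ε) * (∫ ω, |(A ω *ᵥ u.ofLp) 0| ^ p ∂P) ^ (1 / p)
          ≤ vecLpNorm p ((1 / (m : ℝ) ^ (1 / p)) • (A ω *ᵥ u.ofLp)) ∧
        vecLpNorm p ((1 / (m : ℝ) ^ (1 / p)) • (A ω *ᵥ u.ofLp))
          ≤ (1 + ε) * (∫ ω, |(A ω *ᵥ u.ofLp) 0| ^ p ∂P) ^ (1 / p))}
      ≤ 2 * Real.exp (-(ε ^ 2 * (m : ℝ) ^ (2 / max p 2)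
            / (deviationConst p * (12 * K) ^ (6 * p + 2))))
        + 2 * m * Real.exp (-((m : ℝ) ^ (2 / max p 2) / (12 * K) ^ 2)) := by
  have hp0 : 0 < p := by linarith
  set v := ∫ ω, |(A ω *ᵥ u.ofLp) 0| ^ p ∂P with hv
  have hv0 : 0 ≤ v := integral_nonneg fun ω => by positivity
  have hvp : (v ^ (1 / p)) ^ p = v := by
    rw [← Real.rpow_mul hv0, one_div_mul_cancel hp0.ne', Real.rpow_one]
  -- The additive deviation scale lies below the true `p`-th moment, so it counts as a relative
  -- deviation of at most `ε`.
  have hl : (16 * (12 * K) ^ 2) ^ (-p) ≤ (v ^ (1 / p)) ^ p := by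
    have h1 := (hY 0).le_rpow_integral_rpow (hA.integral_mulVec_sq 0 hu) hp
    rw [Real.rpow_neg (by positivity), ← Real.inv_rpow (by positivity), ← one_div]
    exact Real.rpow_le_rpow (by positivity) h1 hp0.le
  have hid : ∀ i, ∫ ω, |(A ω *ᵥ u.ofLp) i| ^ p ∂P = v := fun i =>
    ((hA.identDistrib_mulVec u.ofLp i 0).comp (u := fun x => |x| ^ p) (by fun_prop)).integral_eq
  have h := measureReal_sum_rpow_deviation_le hY (hA.iIndepFun_mulVec u.ofLp) hp (by linarith) hid
    hε hε1
  rw [Fintype.card_fin] at h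
  refine (measureReal_mono fun ω hω => ?_).trans h
  refine fun hmem => hω ?_
  exact vecLpNorm_normalized_mem hp (by positivity) hε hε1 hl (by rw [hvp]; exact hmem.1)
    (by rw [hvp]; exact hmem.2)

end IsSubGaussianEnsemble

theorem mainTheorem4 :
    ∃ C : ℝ, 0 < C ∧ ∀ p : ℝ, 1 ≤ p → ∃ C' Cp : ℝ, 0 < C' ∧ 0 < Cp ∧
      ∀ (Ω : Type*) [MeasurableSpace Ω] (P : Measure Ω) [IsProbabilityMeasure P]
        (m n : ℕ) [NeZero m] [NeZero n] (A : Ω → Matrix (Fin m) (Fin n) ℝ),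
        IsSubGaussianEnsemble A P →
        ∀ K d D : ℝ, K = (orliczNorm 2 (fun ω => A ω 0 0) P).toReal →
          d = lowerConst C p K → D = upperConst C' p K →
          (∀ z : EuclideanSpace ℝ (Fin n),
            ENNReal.ofReal (d * ‖z‖)
                ≤ eLpNorm (fun ω => (A ω *ᵥ z.ofLp) 0) (ENNReal.ofReal p) P ∧
              eLpNorm (fun ω => (A ω *ᵥ z.ofLp) 0) (ENNReal.ofReal p) P
                ≤ ENNReal.ofReal (D * ‖z‖)) ∧
          ∀ (T : Finset (EuclideanSpace ℝ (Fin n))), 2 ≤ T.card →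
            ∀ ε : ℝ, 0 < ε → ε < 1 →
              1 - 2 * Real.exp (-(ε ^ 2 * (m : ℝ) ^ (2 * betaExp p) /
                    (d ^ (-2 : ℝ) * Cp * K ^ (8 * p + 8) * Real.log (T.card : ℝ))))
                ≤ P.real {ω | ∀ x ∈ T, ∀ y ∈ T,
                    d * (1 - ε) * ‖x - y‖
                        ≤ vecLpNorm p
                            ((1 / (m : ℝ) ^ (1 / p)) • (A ω *ᵥ (x - y).ofLp)) ∧
                      vecLpNorm p ((1 / (m : ℝ) ^ (1 / p)) • (A ω *ᵥ (x - y).ofLp))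
                        ≤ D * (1 + ε) * ‖x - y‖} := by
  refine ⟨1 / 2304, by norm_num, fun p hp => ⟨12 * (2 * p ^ (p / 2)) ^ (1 / p),
    concentrationConst p, by positivity, concentrationConst_pos hp, ?_⟩⟩
  intro Ω _ P _ m n _ _ A hA K d D hK hd hD
  have hp0 : 0 < p := by linarith
  have hK1 : 1 ≤ K := hK ▸ hA.one_le_toReal_orliczNorm 0 0
  have hd0 : 0 < d := hd ▸ lowerConst_pos (by norm_num) (by linarith)
  have hd1 : d ≤ 1 := hd ▸ lowerConst_le_one (by norm_num) hK1
  have hY : ∀ {u : EuclideanSpace ℝ (Fin n)}, ‖u‖ = 1 →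
      ∀ i, HasSqExpBound (fun ω => (A ω *ᵥ u.ofLp) i) (12 * K) P := fun hu i =>
    hK ▸ hA.hasSqExpBound_mulVec i 0 0 hu
  have hmom : ∀ {u : EuclideanSpace ℝ (Fin n)}, ‖u‖ = 1 →
      d ≤ (∫ ω, |(A ω *ᵥ u.ofLp) 0| ^ p ∂P) ^ (1 / p) ∧
        (∫ ω, |(A ω *ᵥ u.ofLp) 0| ^ p ∂P) ^ (1 / p) ≤ D := fun hu =>
    ⟨hd ▸ (hY hu 0).lowerConst_le (hA.integral_mulVec_sq 0 hu) hp hK1,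
      hD ▸ (hY hu 0).le_upperConst (hA.integral_mulVec_sq 0 hu) hp⟩
  have hunit : ∀ z : EuclideanSpace ℝ (Fin n), z ≠ 0 →
      ∃ u : EuclideanSpace ℝ (Fin n), ‖u‖ = 1 ∧ ∀ ω, A ω *ᵥ z.ofLp = ‖z‖ • (A ω *ᵥ u.ofLp) := by
    intro z hz
    have hz' : ‖z‖ ≠ 0 := norm_ne_zero_iff.2 hz
    refine ⟨‖z‖⁻¹ • z, by
      rw [norm_smul, norm_inv, norm_norm, inv_mul_cancel₀ hz'], fun ω => ?_⟩
    rw [WithLp.ofLp_smul, Matrix.mulVec_smul, smul_smul, mul_inv_cancel₀ hz', one_smul]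
  constructor
  · intro z
    rcases eq_or_ne z 0 with rfl | hz
    · simp
    obtain ⟨u, hu, hzu⟩ := hunit z hz
    have h1 : (fun ω => (A ω *ᵥ z.ofLp) 0) = ‖z‖ • fun ω => (A ω *ᵥ u.ofLp) 0 := by
      funext ω
      rw [hzu ω]; rfl
    obtain ⟨h2, h3⟩ := hmom hu
    rw [h1, eLpNorm_const_smul, (hY hu 0).eLpNorm_eq hp0, mul_comm d, mul_comm D,
      ENNReal.ofReal_mul (norm_nonneg z), ENNReal.ofReal_mul (norm_nonneg z), enorm_norm,
      ← ofReal_norm]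
    exact ⟨by gcongr, by gcongr⟩
  · intro T hT ε hε hε1
    rw [two_mul_betaExp]
    set s := ε ^ 2 * (m : ℝ) ^ (2 / max p 2) /
      (d ^ (-2 : ℝ) * concentrationConst p * K ^ (8 * p + 8) * Real.log (T.card : ℝ)) with hs
    -- For `s ≤ log 2` the asserted lower bound on the probability is nonpositive.
    rcases le_or_gt s (Real.log 2) with hs2 | hs2
    · have h1 : Real.exp (-Real.log 2) ≤ Real.exp (-s) := Real.exp_le_exp.2 (by linarith)
      rw [Real.exp_neg, Real.exp_log two_pos] at h1
      have : 1 - 2 * Real.exp (-s) ≤ 0 := by linarith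
      exact this.trans measureReal_nonneg
    set q := 2 * Real.exp (-(ε ^ 2 * (m : ℝ) ^ (2 / max p 2)
            / (deviationConst p * (12 * K) ^ (6 * p + 2))))
        + 2 * m * Real.exp (-((m : ℝ) ^ (2 / max p 2) / (12 * K) ^ 2)) with hq
    have hbound : (T.card : ℝ) ^ 2 * q ≤ 2 * Real.exp (-s) :=
      union_bound_le hp hK1 hd0 hd1 hε hε1 (Nat.one_le_cast.2 (NeZero.pos m))
        (by exact_mod_cast hT) hs2
    set good : EuclideanSpace ℝ (Fin n) → Set Ω := fun z =>
      {ω | d * (1 - ε) * ‖z‖ ≤ vecLpNorm p ((1 / (m : ℝ) ^ (1 / p)) • (A ω *ᵥ z.ofLp)) ∧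
        vecLpNorm p ((1 / (m : ℝ) ^ (1 / p)) • (A ω *ᵥ z.ofLp)) ≤ D * (1 + ε) * ‖z‖} with hgood
    have hsingle : ∀ z, P.real (good z)ᶜ ≤ q := by
      intro z
      rcases eq_or_ne z 0 with rfl | hz
      · have h1 : (good 0)ᶜ = ∅ := by
          rw [Set.compl_empty_iff, Set.eq_univ_iff_forall]
          intro ω
          have h0 : vecLpNorm p (0 : Fin m → ℝ) = 0 := by
            simpa using vecLpNorm_smul hp0 le_rfl (0 : Fin m → ℝ)
          simp [hgood, h0]
        rw [h1, measureReal_empty]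
        positivity
      obtain ⟨u, hu, hzu⟩ := hunit z hz
      obtain ⟨h2, h3⟩ := hmom hu
      refine (measureReal_mono fun ω hω => ?_).trans
        (hA.measureReal_vecLpNorm_deviation_le hu hp hK1 (hY hu) hε hε1)
      refine fun hmem => hω ?_
      have h4 : vecLpNorm p ((1 / (m : ℝ) ^ (1 / p)) • (A ω *ᵥ z.ofLp))
          = ‖z‖ * vecLpNorm p ((1 / (m : ℝ) ^ (1 / p)) • (A ω *ᵥ u.ofLp)) := by
        rw [hzu, smul_comm, vecLpNorm_smul hp0 (norm_nonneg z)]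
      change _ ≤ vecLpNorm p _ ∧ vecLpNorm p _ ≤ _
      rw [h4, mul_comm _ ‖z‖, mul_comm _ ‖z‖]
      refine ⟨mul_le_mul_of_nonneg_left (le_trans ?_ hmem.1) (norm_nonneg z),
        mul_le_mul_of_nonneg_left (hmem.2.trans ?_) (norm_nonneg z)⟩
      · rw [mul_comm]
        exact mul_le_mul_of_nonneg_left h2 (by linarith)
      · rw [mul_comm D]
        exact mul_le_mul_of_nonneg_left h3 (by linarith)
    set E := {ω | ∀ x ∈ T, ∀ y ∈ T, ω ∈ good (x - y)} with hE
    change _ ≤ P.real E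
    -- All `N²` ordered pairs are counted, including the diagonal, where the bad event is empty.
    have hsub : Eᶜ ⊆ ⋃ xy ∈ T ×ˢ T, (good (xy.1 - xy.2))ᶜ := by
      intro ω hω
      by_contra hcon
      refine hω fun x hx y hy => ?_
      by_contra hxy
      exact hcon (Set.mem_biUnion (Finset.mem_coe.2 (Finset.mk_mem_product hx hy)) hxy)
    have hcompl : P.real Eᶜ ≤ 2 * Real.exp (-s) := by
      refine (measureReal_mono hsub (measure_ne_top _ _)).trans
        ((measureReal_biUnion_finset_le _ _).trans (le_trans ?_ hbound))
      refine (Finset.sum_le_sum fun xy _ => hsingle (xy.1 - xy.2)).trans_eq ?_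
      rw [Finset.sum_const, Finset.card_product, nsmul_eq_mul]
      push_cast
      ring
    have huniv : (1 : ℝ) ≤ P.real E + P.real Eᶜ := by
      have := measureReal_union_le (μ := P) E Eᶜ
      rwa [Set.union_compl_self, probReal_univ] at this
    linarith
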